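/- Let $d\ge 2$ be an integer, let $P^{anti}$ be the orthogonal projector onto the antisymmetric subspace of $\mathbb C^d\otimes\mathbb C^d$, and for real $\alpha$ let $$\rho_W=\alpha\,\frac{2P^{anti}}{d(d-1)}+(1-\alpha)\,\frac{\mathbb I_{d^2}}{d^2}$$ be the Werner state. Put $\alpha^\ast=\frac{3d-1}{d+1}(d-1)^{d-1}d^{-d}$ and suppose that $\frac1{d+1}<\alpha\le\alpha^\ast$. POVMs have finitely many outcomes. A state is entangled if it is not a finite convex combination of product states. A state $\rho$ admits a local hidden state (LHS) model for POVMs from Alice to Bob if there are a probability measure $\pi$, measurably depending quantum states $\sigma_\lambda$ of Bob, and, for every POVM $M$ of Alice, a response function (a probability distribution $p(\cdot\,|M,\lambda)$ on the outcomes, measurable in $\lambda$), with $$\mathrm{tr}_A\big[(M_a\otimes\mathbb I)\rho\big]=\int p(a|M,\lambda)\,\sigma_\lambda\,d\pi(\lambda)\qquad\text{for all } M \text{ and } a ;$$ $\pi$ and $\sigma_\lambda$ are the same for all $M$. Then Alice cannot steer Bob with POVMs. The definition from Bob to Alice is the same with the parties exchanged. Barrett's model is the following. The hidden variable is a unit vector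 $|\lambda\rangle\in\mathbb C^d$ with the uniform distribution. Write each POVM as a coarse-graining $M_a=\sum_{k:\,f(k)=a}w_kP_k$ with $w_k\ge0$ and rank-one projectors $P_k$, which is always possible; fix any such choice for every POVM. Put $q_k(\lambda)=\langle\lambda|P_k|\lambda\rangle$, and let $c_k(\lambda)=w_kq_k(\lambda)$ if $q_k(\lambda)\ge\frac1d$ and $c_k(\lambda)=0$ otherwise. The response functions of the two parties are $$p_1(a|M,\lambda)=\sum_{f(k)=a}\Big[\tfrac{\alpha}{\alpha^\ast}\Big(c_k(\lambda)+\tfrac{w_k}{d}\big(1-\textstyle\sum_{k'}c_{k'}(\lambda)\big)\Big)+\big(1-\tfrac{\alpha}{\alpha^\ast}\big)\tfrac{w_k}{d}\Big],$$ $$p_2(a|M,\lambda)=\sum_{f(k)=a}\frac{w_k}{d-1}\big(1-\mathrm{tr}[|\lambda\rangle\langle\lambda|P_k]\big).$$ Then: 1. $\rho_W$ is an entangled state. 2. Barrett's model is a local hidden variable model for all POVMs on $\rho_W$: $p_1$ and $p_2$ are response functions and $\mathrm{tr}[(M_a\otimes N_b)\rho_W]=\int p_1(a|M,\lambda)\,p_2(b|N,\lambda)\,d\lambda$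 for all POVMs $M,N$ and outcomes $a,b$; the same holds with the roles of the two parties exchanged. 3. It is an LHS model with hidden states $\sigma_\lambda=\frac{\mathbb I_d-|\lambda\rangle\langle\lambda|}{d-1}$: one has $p_2(a|M,\lambda)=\mathrm{tr}(\sigma_\lambda M_a)$ for all $M$, $a$, $\lambda$, and $p_1$ with the hidden states $\sigma_\lambda$ is an LHS model for POVMs of $\rho_W$, both from Alice to Bob and from Bob to Alice. 4. Hence $\rho_W$ cannot be steered with POVMs from Alice to Bob, nor from Bob to Alice. -/

import Mathlib

open MeasureTheory
open scoped Kronecker ComplexOrder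

noncomputable section

namespace Steering

variable {ι κ : Type} [Fintype ι] [DecidableEq ι] [Fintype κ] [DecidableEq κ]

/-- A quantum state (density matrix): positive semidefinite with unit trace. -/
structure IsState (ρ : Matrix ι ι ℂ) : Prop where
  posSemidef : ρ.PosSemidef
  trace_eq_one : ρ.trace = 1

/-- A bipartite matrix is separable if it is a finite convex combination of products of states. -/
def IsSeparable (ρ : Matrix (ι × κ) (ι × κ) ℂ) : Prop :=
  ∃ (k : ℕ) (p : Fin k → ℝ) (σ : Fin k → Matrix ι ι ℂ) (τ : Fin k → Matrix κ κ ℂ),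
    (∀ i, 0 ≤ p i) ∧ ∑ i, p i = 1 ∧ (∀ i, IsState (σ i)) ∧ (∀ i, IsState (τ i)) ∧
      ρ = ∑ i, (p i : ℂ) • (σ i ⊗ₖ τ i)

/-- An entangled state is a state that is not separable. -/
def IsEntangled (ρ : Matrix (ι × κ) (ι × κ) ℂ) : Prop :=
  IsState ρ ∧ ¬ IsSeparable ρ

/-- A POVM with `n` outcomes on the Hilbert space with orthonormal basis indexed by `ι`. -/
structure POVM (ι : Type) [Fintype ι] [DecidableEq ι] (n : ℕ) where
  elem : Fin n → Matrix ι ι ℂ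
  posSemidef : ∀ a, (elem a).PosSemidef
  sum_eq_one : ∑ a, elem a = 1

/-- Partial trace over the first (Alice's) factor. -/
def traceA (X : Matrix (ι × κ) (ι × κ) ℂ) : Matrix κ κ ℂ :=
  Matrix.of fun i j => ∑ k, X (k, i) (k, j)

/-- Partial trace over the second (Bob's) factor. -/
def traceB (X : Matrix (ι × κ) (ι × κ) ℂ) : Matrix ι ι ℂ :=
  Matrix.of fun i j => ∑ k, X (i, k) (j, k)

/-- The full assemblage of subnormalised states of Bob: for each POVM `M` of Alice and each
outcome `a`, the matrix `tr_A ((M_a ⊗ 1) ρ)`. -/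
def assemblageAtoB (ρ : Matrix (ι × κ) (ι × κ) ℂ) (n : ℕ) (M : POVM ι n) (a : Fin n) :
    Matrix κ κ ℂ :=
  traceA ((M.elem a ⊗ₖ (1 : Matrix κ κ ℂ)) * ρ)

/-- The full assemblage of subnormalised states of Alice: for each POVM `M` of Bob and each
outcome `b`, the matrix `tr_B ((1 ⊗ M_b) ρ)`. -/
def assemblageBtoA (ρ : Matrix (ι × κ) (ι × κ) ℂ) (n : ℕ) (M : POVM κ n) (b : Fin n) :
    Matrix ι ι ℂ :=
  traceB (((1 : Matrix ι ι ℂ) ⊗ₖ M.elem b) * ρ)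

/-- A family of local response functions `p n M a l = p(a | M, l)`: for every POVM `M` and every
value `l` of the hidden variable, a probability distribution on the outcomes, depending
measurably on `l`. -/
structure IsResponse {Λ : Type} [MeasurableSpace Λ]
    (p : (n : ℕ) → POVM ι n → Fin n → Λ → ℝ) : Prop where
  measurable : ∀ n M a, Measurable (p n M a)
  nonneg : ∀ n M a l, 0 ≤ p n M a l
  sum_eq_one : ∀ n M l, ∑ a, p n M a l = 1

/-- The hidden variable `l` with law `μ`, the hidden states `σ l` and the response functions `p`
form a local hidden state model for the assemblage `S` indexed by all POVMs:
`S_{a|M} = ∫ p(a | M, l) σ_l dμ(l)`, the integral being taken entrywise. -/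
structure IsLHSModel (S : (n : ℕ) → POVM ι n → Fin n → Matrix κ κ ℂ)
    {Λ : Type} [MeasurableSpace Λ] (μ : Measure Λ) (σ : Λ → Matrix κ κ ℂ)
    (p : (n : ℕ) → POVM ι n → Fin n → Λ → ℝ) : Prop where
  isProbabilityMeasure : IsProbabilityMeasure μ
  measurable_state : ∀ i j, Measurable fun l => σ l i j
  isState : ∀ l, IsState (σ l)
  isResponse : IsResponse p
  reproduces : ∀ n M a i j, S n M a i j = ∫ l, (p n M a l : ℂ) * σ l i j ∂μ

/-- Existence of a local hidden state model, valid for all POVMs simultaneously. -/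
def HasLHSModel (S : (n : ℕ) → POVM ι n → Fin n → Matrix κ κ ℂ) : Prop :=
  ∃ (Λ : Type) (_ : MeasurableSpace Λ) (μ : Measure Λ) (σ : Λ → Matrix κ κ ℂ)
    (p : (n : ℕ) → POVM ι n → Fin n → Λ → ℝ), IsLHSModel S μ σ p

/-- Alice cannot steer Bob with POVMs. -/
def UnsteerableAtoB (ρ : Matrix (ι × κ) (ι × κ) ℂ) : Prop :=
  HasLHSModel (assemblageAtoB ρ)

/-- Bob cannot steer Alice with POVMs. -/
def UnsteerableBtoA (ρ : Matrix (ι × κ) (ι × κ) ℂ) : Prop :=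
  HasLHSModel (assemblageBtoA ρ)

/-- A local hidden variable model for all pairs of POVMs performed on `ρ`. -/
structure IsLHVModel (ρ : Matrix (ι × κ) (ι × κ) ℂ)
    {Λ : Type} [MeasurableSpace Λ] (μ : Measure Λ)
    (pA : (n : ℕ) → POVM ι n → Fin n → Λ → ℝ)
    (pB : (n : ℕ) → POVM κ n → Fin n → Λ → ℝ) : Prop where
  isProbabilityMeasure : IsProbabilityMeasure μ
  isResponseA : IsResponse pA
  isResponseB : IsResponse pB
  reproduces : ∀ (m n : ℕ) (M : POVM ι m) (N : POVM κ n) (a : Fin m) (b : Fin n),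
    ((M.elem a ⊗ₖ N.elem b) * ρ).trace = ((∫ l, pA m M a l * pB n N b l ∂μ : ℝ) : ℂ)

/-! ### Werner states -/

/-- The swap operator on `ℂ^d ⊗ ℂ^d`. -/
def swapMatrix (d : ℕ) : Matrix (Fin d × Fin d) (Fin d × Fin d) ℂ :=
  Matrix.of fun i j => if i = j.swap then 1 else 0

/-- The projector on the antisymmetric subspace of `ℂ^d ⊗ ℂ^d`; it is shown
below to be Hermitian and idempotent, with the antisymmetric vectors as its fixed points. -/
def antisymProj (d : ℕ) : Matrix (Fin d × Fin d) (Fin d × Fin d) ℂ :=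
  (1 / 2 : ℂ) • (1 - swapMatrix d)

theorem swapMatrix_mulVec (d : ℕ) (v : Fin d × Fin d → ℂ) (i : Fin d × Fin d) :
    (swapMatrix d).mulVec v i = v i.swap := by
  have h : ∀ x : Fin d × Fin d, (i = x.swap) ↔ (i.swap = x) := fun x =>
    ⟨fun h => by rw [h, Prod.swap_swap], fun h => by rw [← h, Prod.swap_swap]⟩
  simp [swapMatrix, Matrix.mulVec, dotProduct, h]

theorem antisymProj_mulVec (d : ℕ) (v : Fin d × Fin d → ℂ) (i : Fin d × Fin d) :
    (antisymProj d).mulVec v i = (v i - v i.swap) / 2 := by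
  rw [antisymProj, Matrix.smul_mulVec, Matrix.sub_mulVec, Matrix.one_mulVec]
  simp only [Pi.smul_apply, Pi.sub_apply, swapMatrix_mulVec, smul_eq_mul]
  ring

theorem antisymProj_isHermitian (d : ℕ) : (antisymProj d).IsHermitian := by
  have h1 : (swapMatrix d).IsHermitian := by
    ext ⟨i, i'⟩ ⟨j, j'⟩
    have h : (j = i' ∧ j' = i) ↔ (i = j' ∧ i' = j) :=
      ⟨fun h => ⟨h.2.symm, h.1.symm⟩, fun h => ⟨h.2.symm, h.1.symm⟩⟩
    simp [swapMatrix, h, apply_ite]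
  have h2 : star (1 / 2 : ℂ) = 1 / 2 := by simp
  rw [Matrix.IsHermitian, antisymProj, Matrix.conjTranspose_smul, Matrix.conjTranspose_sub,
    Matrix.conjTranspose_one, h1.eq, h2]

theorem antisymProj_mul_self (d : ℕ) : antisymProj d * antisymProj d = antisymProj d := by
  refine Matrix.ext_of_mulVec_single fun k => ?_
  rw [← Matrix.mulVec_mulVec]
  ext i
  rw [antisymProj_mulVec, antisymProj_mulVec, antisymProj_mulVec, Prod.swap_swap]
  ring

theorem antisymProj_mulVec_eq_self_iff (d : ℕ) (v : Fin d × Fin d → ℂ) :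
    (antisymProj d).mulVec v = v ↔ ∀ i j, v (j, i) = -v (i, j) := by
  constructor
  · intro h i j
    have := congrFun h (i, j)
    rw [antisymProj_mulVec, Prod.swap_prod_mk] at this
    linear_combination (-2 : ℂ) * this
  · intro h
    ext ⟨i, j⟩
    rw [antisymProj_mulVec, Prod.swap_prod_mk, h i j]
    ring

/-- The Werner state `α · 2 P^anti / (d (d-1)) + (1 - α) · 1 / d²`. -/
def wernerState (d : ℕ) (α : ℝ) : Matrix (Fin d × Fin d) (Fin d × Fin d) ℂ :=
  ((α * (2 / ((d : ℝ) * ((d : ℝ) - 1))) : ℝ) : ℂ) • antisymProj d +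
    (((1 - α) / (d : ℝ) ^ 2 : ℝ) : ℂ) • (1 : Matrix (Fin d × Fin d) (Fin d × Fin d) ℂ)

/-- The threshold `(3d-1)/(d+1) · (d-1)^(d-1) · d^(-d)`. -/
def barrettBound (d : ℕ) : ℝ :=
  (3 * (d : ℝ) - 1) / ((d : ℝ) + 1) * ((d : ℝ) - 1) ^ (d - 1) * ((d : ℝ) ^ d)⁻¹

/-! ### Barrett's model -/

/-- Unit vectors of `ℂ^d`. -/
abbrev UnitVec (d : ℕ) : Type := Metric.sphere (0 : EuclideanSpace ℂ (Fin d)) 1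

/-- The uniform (unitarily invariant) probability measure on unit vectors: normalised surface
measure. -/
def uniformUnitVec (d : ℕ) : Measure (UnitVec d) :=
  ((volume : Measure (EuclideanSpace ℂ (Fin d))).toSphere Set.univ)⁻¹ •
    (volume : Measure (EuclideanSpace ℂ (Fin d))).toSphere

/-- The projector `|v⟩⟨v|`. -/
def ketbra {d : ℕ} (v : UnitVec d) : Matrix (Fin d) (Fin d) ℂ :=
  Matrix.of fun i j => v.1 i * star (v.1 j)

/-- The overlap `tr (|v⟩⟨v| |w⟩⟨w|) = |⟨v, w⟩|²`. -/
def overlap {d : ℕ} (v w : UnitVec d) : ℝ := ‖inner ℂ v.1 w.1‖ ^ 2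

/-- The hidden state `(1 - |l⟩⟨l|) / (d - 1)`. -/
def hiddenState (d : ℕ) (l : UnitVec d) : Matrix (Fin d) (Fin d) ℂ :=
  (((d : ℝ) - 1 : ℝ) : ℂ)⁻¹ • (1 - ketbra l)

/-- A fine-graining of the POVM `M` into rank-one elements `weight k • |vec k⟩⟨vec k|`, the
outcome `k` of which is relabelled `label k`. -/
structure RankOneRefinement {d n : ℕ} (M : POVM (Fin d) n) where
  size : ℕ
  weight : Fin size → ℝ
  weight_nonneg : ∀ k, 0 ≤ weight k
  vec : Fin size → UnitVec d
  label : Fin size → Fin n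
  elem_eq : ∀ a, M.elem a = ∑ k with label k = a, (weight k : ℂ) • ketbra (vec k)

namespace RankOneRefinement

variable {d n : ℕ} {M : POVM (Fin d) n}

/-- `⟨l| M_k |l⟩ Θ(⟨l| P_k |l⟩ - 1/d)` for the rank-one element `M_k = w_k P_k`. -/
def clipped (R : RankOneRefinement M) (k : Fin R.size) (l : UnitVec d) : ℝ :=
  if 1 / (d : ℝ) ≤ overlap (R.vec k) l then R.weight k * overlap (R.vec k) l else 0

/-- The response of the untrusted party at the threshold visibility. -/
def response (R : RankOneRefinement M) (a : Fin n) (l : UnitVec d) : ℝ :=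
  ∑ k with R.label k = a,
    (R.clipped k l + R.weight k / (d : ℝ) * (1 - ∑ k', R.clipped k' l))

/-- White noise: the outcome `k` is drawn with probability `w_k / d`. -/
def noise (R : RankOneRefinement M) (a : Fin n) : ℝ :=
  ∑ k with R.label k = a, R.weight k / (d : ℝ)

/-- The response of the other party, `w_k / (d-1) · (1 - tr (|l⟩⟨l| P_k))`. -/
def quantumResponse (R : RankOneRefinement M) (a : Fin n) (l : UnitVec d) : ℝ :=
  ∑ k with R.label k = a, R.weight k / ((d : ℝ) - 1) * (1 - overlap (R.vec k) l)

end RankOneRefinement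

/-- First response function of Barrett's model at visibility `α`: the response at the threshold
visibility, mixed with white noise in proportion `1 - α / barrettBound d`. -/
def barrettResponse {d : ℕ} (α : ℝ)
    (R : (n : ℕ) → (M : POVM (Fin d) n) → RankOneRefinement M)
    (n : ℕ) (M : POVM (Fin d) n) (a : Fin n) (l : UnitVec d) : ℝ :=
  α / barrettBound d * (R n M).response a l + (1 - α / barrettBound d) * (R n M).noise a

/-- Second response function of Barrett's model. -/
def barrettQuantumResponse {d : ℕ}
    (R : (n : ℕ) → (M : POVM (Fin d) n) → RankOneRefinement M)
    (n : ℕ) (M : POVM (Fin d) n) (a : Fin n) (l : UnitVec d) : ℝ :=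
  (R n M).quantumResponse a l

end Steering

end

/-!
A product state has nonnegative expectation of the swap operator `F`, since
`tr (F (σ ⊗ τ)) = tr (σ τ)`, whereas this expectation is `(1 - α (d + 1)) / d` for the Werner
state, which is therefore entangled for `α > 1 / (d + 1)`.

For the model, fix a unit vector `v`. The average `∫ h(|⟨v, l⟩|²) |l⟩⟨l| dl` commutes with every
`|u⟩⟨u|` that commutes with `|v⟩⟨v|`, by invariance of the uniform measure under the reflections
`2 |u⟩⟨u| - 1`. So it has the form `a |v⟩⟨v| + b 1`, and `a`, `b` are determined by two scalar
integrals against the law of the overlap `|⟨v, l⟩|²`. The overlap exceeds `t` with probability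
`(1 - t) ^ (d - 1)`; this is read off from the Gaussian measure of the cone `t ‖x‖² < ‖P x‖²`,
with `P` the projection onto the complex line of `v`, a real plane. With `h q = q` for `q ≥ 1 / d`
and `h q = 0` otherwise this yields the threshold, and the hidden states averaged against the
first response are Bob's assemblage. The second response is the quantum one on the hidden states,
so the LHS model is also an LHV model; swap symmetry of the Werner state gives the other direction.
-/

noncomputable section

namespace Steering

section PositiveMatrices

variable {ι : Type} [Fintype ι]

theorem posSemidef_of_isStarProjection {P : Matrix ι ι ℂ} (hP : IsStarProjection P) :
    P.PosSemidef := by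
  rw [← hP.isIdempotentElem.eq]
  nth_rw 1 [← hP.isSelfAdjoint.star_eq]
  exact Matrix.posSemidef_conjTranspose_mul_self P

theorem trace_mul_nonneg {σ τ : Matrix ι ι ℂ} (hσ : σ.PosSemidef) (hτ : τ.PosSemidef) :
    0 ≤ (σ * τ).trace := by
  classical
  open scoped MatrixOrder Matrix.Norms.L2Operator in
  obtain ⟨B, hB⟩ := CStarAlgebra.nonneg_iff_eq_star_mul_self.1 hσ.nonneg
  rw [hB, Matrix.star_eq_conjTranspose, Matrix.mul_assoc, Matrix.trace_mul_comm]
  exact (hτ.mul_mul_conjTranspose_same B).trace_nonneg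

theorem IsState.norm_apply_le_one {ρ : Matrix ι ι ℂ} (hρ : IsState ρ) (i j : ι) :
    ‖ρ i j‖ ≤ 1 := by
  have hdiag (k : ι) : 0 ≤ ρ k k := hρ.posSemidef.diag_nonneg
  have hdiag_norm (k : ι) : ‖ρ k k‖ ≤ 1 := by
    have hle : ρ k k ≤ 1 := by
      rw [← hρ.trace_eq_one]
      exact Finset.single_le_sum (f := ρ.diag) (fun k _ => hdiag k) (Finset.mem_univ k)
    simpa using CStarAlgebra.norm_le_norm_of_nonneg_of_le (hdiag k) hle
  have hminor : ρ i j * star (ρ i j) ≤ ρ i i * ρ j j := by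
    have h := (hρ.posSemidef.submatrix ![i, j]).det_nonneg
    simp only [Matrix.det_fin_two, Matrix.submatrix_apply, Matrix.cons_val_zero,
      Matrix.cons_val_one, sub_nonneg] at h
    rwa [hρ.posSemidef.isHermitian.apply]
  have hsq : ‖ρ i j‖ * ‖ρ i j‖ ≤ ‖ρ i i‖ * ‖ρ j j‖ := by
    simpa using CStarAlgebra.norm_le_norm_of_nonneg_of_le (mul_star_self_nonneg (ρ i j)) hminor
  nlinarith [mul_le_one₀ (hdiag_norm i) (norm_nonneg _) (hdiag_norm j), norm_nonneg (ρ i j)]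

end PositiveMatrices

section PartialTrace

variable {ι κ : Type} [Fintype ι]

theorem traceA_sub (X Y : Matrix (ι × κ) (ι × κ) ℂ) : traceA (X - Y) = traceA X - traceA Y := by
  ext
  simp [traceA]

theorem traceA_smul (c : ℂ) (X : Matrix (ι × κ) (ι × κ) ℂ) : traceA (c • X) = c • traceA X := by
  ext
  simp [traceA, Finset.mul_sum]

theorem traceA_kronecker (X : Matrix ι ι ℂ) (Y : Matrix κ κ ℂ) :
    traceA (X ⊗ₖ Y) = X.trace • Y := by
  ext
  simp [traceA, Matrix.trace, Finset.sum_mul]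

variable [Fintype κ]

theorem kronecker_mul_submatrix_swap (A : Matrix ι ι ℂ) (B : Matrix κ κ ℂ)
    (ρ : Matrix (ι × κ) (ι × κ) ℂ) :
    (B ⊗ₖ A) * ρ.submatrix Prod.swap Prod.swap =
      ((A ⊗ₖ B) * ρ).submatrix Prod.swap Prod.swap := by
  have h : B ⊗ₖ A = (A ⊗ₖ B).submatrix Prod.swap Prod.swap := by
    ext
    simp [mul_comm]
  rw [h]
  exact Matrix.submatrix_mul_equiv _ _ _ (Equiv.prodComm κ ι) _

theorem trace_kronecker_mul_submatrix_swap (A : Matrix ι ι ℂ) (B : Matrix κ κ ℂ)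
    (ρ : Matrix (ι × κ) (ι × κ) ℂ) :
    ((B ⊗ₖ A) * ρ.submatrix Prod.swap Prod.swap).trace = ((A ⊗ₖ B) * ρ).trace := by
  rw [kronecker_mul_submatrix_swap]
  exact (Equiv.prodComm κ ι).sum_comp fun i => ((A ⊗ₖ B) * ρ) i i

theorem trace_traceA_mul [DecidableEq ι] (X : Matrix (ι × κ) (ι × κ) ℂ) (B : Matrix κ κ ℂ) :
    (traceA X * B).trace = (X * ((1 : Matrix ι ι ℂ) ⊗ₖ B)).trace := by
  simp only [Matrix.trace, Matrix.diag, Matrix.mul_apply, traceA, Matrix.of_apply,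
    Matrix.kroneckerMap_apply, Fintype.sum_prod_type, Matrix.one_apply, ite_mul, one_mul, zero_mul,
    mul_ite, mul_zero, Finset.sum_ite_irrel, Finset.sum_ite_eq', Finset.sum_const_zero,
    Finset.mem_univ, if_true, Finset.sum_mul]
  rw [Finset.sum_comm_cycle]

variable [DecidableEq κ]

theorem trace_kronecker_mul (A : Matrix ι ι ℂ) (B : Matrix κ κ ℂ)
    (ρ : Matrix (ι × κ) (ι × κ) ℂ) :
    ((A ⊗ₖ B) * ρ).trace = (traceA ((A ⊗ₖ (1 : Matrix κ κ ℂ)) * ρ) * B).trace := by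
  classical
  rw [trace_traceA_mul, Matrix.trace_mul_comm _ (1 ⊗ₖ B), ← Matrix.mul_assoc,
    ← Matrix.mul_kronecker_mul, one_mul, mul_one]

variable [DecidableEq ι]

theorem assemblageAtoB_submatrix_swap (ρ : Matrix (ι × κ) (ι × κ) ℂ) :
    assemblageAtoB (ρ.submatrix Prod.swap Prod.swap) = assemblageBtoA ρ := by
  funext n M a
  rw [assemblageAtoB, kronecker_mul_submatrix_swap]
  rfl

theorem IsLHVModel.submatrix_swap {ρ : Matrix (ι × κ) (ι × κ) ℂ} {Λ : Type} [MeasurableSpace Λ]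
    {μ : Measure Λ} {pA : (n : ℕ) → POVM ι n → Fin n → Λ → ℝ}
    {pB : (n : ℕ) → POVM κ n → Fin n → Λ → ℝ} (h : IsLHVModel ρ μ pA pB) :
    IsLHVModel (ρ.submatrix Prod.swap Prod.swap) μ pB pA where
  isProbabilityMeasure := h.isProbabilityMeasure
  isResponseA := h.isResponseB
  isResponseB := h.isResponseA
  reproduces m n M N a b := by
    rw [trace_kronecker_mul_submatrix_swap, h.reproduces]
    simp only [mul_comm]

end PartialTrace

section Ensembles

variable {ι κ : Type} [Fintype ι] [DecidableEq ι]
  {Λ : Type} [MeasurableSpace Λ] {μ : Measure Λ} {σ : Λ → Matrix κ κ ℂ} {f g : Λ → ℝ}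

/-- The unnormalised mixture `∫ f(l) σ_l dμ(l)` of a family of matrices, taken entrywise as in
`IsLHSModel`. -/
def mixture (μ : Measure Λ) (σ : Λ → Matrix κ κ ℂ) (f : Λ → ℝ) : Matrix κ κ ℂ :=
  Matrix.of fun i j => ∫ l, (f l : ℂ) * σ l i j ∂μ

theorem mixture_const_mul (c : ℝ) :
    mixture μ σ (fun l => c * f l) = (c : ℂ) • mixture μ σ f := by
  ext i j
  simp only [mixture, Matrix.of_apply, Matrix.smul_apply, smul_eq_mul, Complex.ofReal_mul,
    mul_assoc, integral_const_mul]

variable [Fintype κ]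

/-- A measurable family of quantum states. -/
structure IsStateFamily (σ : Λ → Matrix κ κ ℂ) : Prop where
  measurable : ∀ i j, Measurable fun l => σ l i j
  isState : ∀ l, IsState (σ l)

theorem IsStateFamily.integrable_mul (hσ : IsStateFamily σ) (hf : Integrable f μ) (i j : κ) :
    Integrable (fun l => (f l : ℂ) * σ l i j) μ :=
  hf.ofReal.mul_bdd (c := 1) (hσ.measurable i j).aestronglyMeasurable
    (.of_forall fun l => (hσ.isState l).norm_apply_le_one i j)

theorem mixture_add (hσ : IsStateFamily σ) (hf : Integrable f μ) (hg : Integrable g μ) :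
    mixture μ σ (fun l => f l + g l) = mixture μ σ f + mixture μ σ g := by
  ext i j
  simp only [mixture, Matrix.of_apply, Matrix.add_apply, Complex.ofReal_add, add_mul]
  exact integral_add (hσ.integrable_mul hf i j) (hσ.integrable_mul hg i j)

theorem mixture_sub (hσ : IsStateFamily σ) (hf : Integrable f μ) (hg : Integrable g μ) :
    mixture μ σ (fun l => f l - g l) = mixture μ σ f - mixture μ σ g := by
  ext i j
  simp only [mixture, Matrix.of_apply, Matrix.sub_apply, Complex.ofReal_sub, sub_mul]
  exact integral_sub (hσ.integrable_mul hf i j) (hσ.integrable_mul hg i j)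

theorem mixture_sum {α : Type*} {s : Finset α} {f : α → Λ → ℝ} (hσ : IsStateFamily σ)
    (hf : ∀ k ∈ s, Integrable (f k) μ) :
    mixture μ σ (fun l => ∑ k ∈ s, f k l) = ∑ k ∈ s, mixture μ σ (f k) := by
  ext i j
  simp only [mixture, Matrix.of_apply, Matrix.sum_apply, Complex.ofReal_sum, Finset.sum_mul]
  exact integral_finsetSum s fun k hk => hσ.integrable_mul (hf k hk) i j

theorem trace_mixture_mul (hσ : IsStateFamily σ) (hf : Integrable f μ) (B : Matrix κ κ ℂ) :
    (mixture μ σ f * B).trace = ∫ l, (f l : ℂ) * (σ l * B).trace ∂μ := by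
  have hint (i j : κ) : Integrable (fun l => (f l : ℂ) * (σ l i j * B j i)) μ := by
    simpa only [mul_assoc] using (hσ.integrable_mul hf i j).mul_const (B j i)
  simp only [Matrix.trace, Matrix.diag, Matrix.mul_apply, mixture, Matrix.of_apply,
    Finset.mul_sum, ← integral_mul_const, mul_assoc]
  rw [integral_finsetSum _ fun i _ => integrable_finsetSum _ fun j _ => hint i j]
  exact Finset.sum_congr rfl fun i _ => (integral_finsetSum _ fun j _ => hint i j).symm

theorem trace_mixture (hσ : IsStateFamily σ) (hf : Integrable f μ) :
    (mixture μ σ f).trace = ((∫ l, f l ∂μ : ℝ) : ℂ) := by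
  classical
  rw [← mul_one (mixture μ σ f), trace_mixture_mul hσ hf, ← integral_complex_ofReal]
  simp only [mul_one, (hσ.isState _).trace_eq_one]

theorem IsResponse.integrable [IsFiniteMeasure μ] {p : (n : ℕ) → POVM ι n → Fin n → Λ → ℝ}
    (hp : IsResponse p) (n : ℕ) (M : POVM ι n) (a : Fin n) : Integrable (p n M a) μ := by
  refine .of_bound (hp.measurable n M a).aestronglyMeasurable 1 (.of_forall fun l => ?_)
  rw [Real.norm_of_nonneg (hp.nonneg n M a l), ← hp.sum_eq_one n M l]
  exact Finset.single_le_sum (fun b _ => hp.nonneg n M b l) (Finset.mem_univ a)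

theorem IsLHSModel.isLHVModel [DecidableEq κ] {ρ : Matrix (ι × κ) (ι × κ) ℂ}
    {pA : (n : ℕ) → POVM ι n → Fin n → Λ → ℝ} {pB : (n : ℕ) → POVM κ n → Fin n → Λ → ℝ}
    (h : IsLHSModel (assemblageAtoB ρ) μ σ pA) (hpB : IsResponse pB)
    (htrace : ∀ n N b l, (pB n N b l : ℂ) = (σ l * N.elem b).trace) :
    IsLHVModel ρ μ pA pB where
  isProbabilityMeasure := h.isProbabilityMeasure
  isResponseA := h.isResponse
  isResponseB := hpB
  reproduces m n M N a b := by
    have := h.isProbabilityMeasure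
    have hmix : assemblageAtoB ρ m M a = mixture μ σ (pA m M a) :=
      Matrix.ext (h.reproduces m M a)
    calc ((M.elem a ⊗ₖ N.elem b) * ρ).trace
        = (mixture μ σ (pA m M a) * N.elem b).trace := by
          rw [trace_kronecker_mul, ← hmix, assemblageAtoB]
      _ = ∫ l, (pA m M a l : ℂ) * (σ l * N.elem b).trace ∂μ :=
          trace_mixture_mul ⟨h.measurable_state, h.isState⟩ (h.isResponse.integrable m M a) _
      _ = ((∫ l, pA m M a l * pB n N b l ∂μ : ℝ) : ℂ) := by
          simp only [← htrace, ← Complex.ofReal_mul, integral_complex_ofReal]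

end Ensembles

section Werner

variable {d : ℕ}

theorem swapMatrix_apply (i j k l : Fin d) : swapMatrix d (i, j) (k, l) =
    (1 : Matrix (Fin d) (Fin d) ℂ) i l * (1 : Matrix (Fin d) (Fin d) ℂ) j k := by
  simp [swapMatrix, Matrix.one_apply, Prod.ext_iff, and_comm, ← ite_and]

theorem swapMatrix_submatrix_swap :
    (swapMatrix d).submatrix Prod.swap Prod.swap = swapMatrix d := by
  ext ⟨i, j⟩ ⟨k, l⟩
  simp only [Matrix.submatrix_apply, Prod.swap_prod_mk, swapMatrix_apply, mul_comm]

theorem trace_swapMatrix : (swapMatrix d).trace = d := by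
  simp [Matrix.trace, Fintype.sum_prod_type, swapMatrix_apply, Matrix.one_apply]

theorem swapMatrix_mul_self : swapMatrix d * swapMatrix d = 1 := by
  refine Matrix.ext_of_mulVec_single fun k => ?_
  ext i
  rw [← Matrix.mulVec_mulVec, swapMatrix_mulVec, swapMatrix_mulVec, Prod.swap_swap,
    Matrix.one_mulVec]

theorem trace_swapMatrix_mul_kronecker (σ τ : Matrix (Fin d) (Fin d) ℂ) :
    (swapMatrix d * (σ ⊗ₖ τ)).trace = (σ * τ).trace := by
  simp only [Matrix.trace, Matrix.diag, Matrix.mul_apply, Fintype.sum_prod_type, swapMatrix_apply,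
    Matrix.kroneckerMap_apply, Matrix.one_apply, ite_mul, one_mul, zero_mul,
    Finset.sum_ite_eq, Finset.mem_univ, if_true]
  exact Finset.sum_comm

theorem traceA_kronecker_one_mul_swapMatrix (X : Matrix (Fin d) (Fin d) ℂ) :
    traceA ((X ⊗ₖ (1 : Matrix (Fin d) (Fin d) ℂ)) * swapMatrix d) = X := by
  ext i j
  simp [traceA, Matrix.mul_apply, Fintype.sum_prod_type, swapMatrix_apply, Matrix.one_apply]

theorem wernerState_eq_smul_one_sub_smul_swapMatrix (d : ℕ) (α : ℝ) :
    wernerState d α =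
      (α / (d * (d - 1)) + (1 - α) / d ^ 2 : ℂ) • 1 - (α / (d * (d - 1)) : ℂ) • swapMatrix d := by
  rw [wernerState, antisymProj]
  push_cast
  module

theorem wernerState_submatrix_swap (α : ℝ) :
    (wernerState d α).submatrix Prod.swap Prod.swap = wernerState d α := by
  rw [wernerState_eq_smul_one_sub_smul_swapMatrix, Matrix.submatrix_sub, Matrix.submatrix_smul,
    Matrix.submatrix_smul]
  simp only [Pi.sub_apply, Pi.smul_apply, swapMatrix_submatrix_swap]
  rw [Matrix.submatrix_one _ Prod.swap_injective]

theorem assemblageAtoB_wernerState (α : ℝ) {n : ℕ} (M : POVM (Fin d) n) (a : Fin n) :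
    assemblageAtoB (wernerState d α) n M a =
      ((α / (d * (d - 1)) + (1 - α) / d ^ 2) * (M.elem a).trace : ℂ) • 1 -
        (α / (d * (d - 1)) : ℂ) • M.elem a := by
  rw [assemblageAtoB, wernerState_eq_smul_one_sub_smul_swapMatrix, mul_sub, mul_smul_comm,
    mul_smul_comm, mul_one, traceA_sub, traceA_smul, traceA_smul, traceA_kronecker,
    traceA_kronecker_one_mul_swapMatrix, smul_smul]

theorem trace_wernerState (hd : 2 ≤ d) (α : ℝ) : (wernerState d α).trace = 1 := by
  have hd0 : (d : ℂ) ≠ 0 := Nat.cast_ne_zero.2 (by omega)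
  have hd1 : (d : ℂ) - 1 ≠ 0 := sub_ne_zero.2 (Nat.cast_ne_one.2 (by omega))
  rw [wernerState_eq_smul_one_sub_smul_swapMatrix, Matrix.trace_sub, Matrix.trace_smul,
    Matrix.trace_smul, Matrix.trace_one, trace_swapMatrix, Fintype.card_prod, Fintype.card_fin]
  push_cast
  simp only [smul_eq_mul]
  field_simp
  ring

theorem isState_wernerState (hd : 2 ≤ d) {α : ℝ} (h0 : 0 ≤ α) (h1 : α ≤ 1) :
    IsState (wernerState d α) where
  posSemidef := by
    have hd' : (2 : ℝ) ≤ d := by exact_mod_cast hd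
    have hd1 : (0 : ℝ) < (d : ℝ) - 1 := by linarith
    have hanti : (antisymProj d).PosSemidef :=
      posSemidef_of_isStarProjection ⟨antisymProj_mul_self d, antisymProj_isHermitian d⟩
    refine (hanti.smul ?_).add (Matrix.PosSemidef.one.smul ?_)
    · exact Complex.zero_le_real.2 (by positivity)
    · exact Complex.zero_le_real.2 (div_nonneg (sub_nonneg.2 h1) (by positivity))
  trace_eq_one := trace_wernerState hd α

theorem IsSeparable.trace_swapMatrix_mul_nonneg {ρ : Matrix (Fin d × Fin d) (Fin d × Fin d) ℂ}
    (h : IsSeparable ρ) : 0 ≤ (swapMatrix d * ρ).trace := by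
  obtain ⟨k, p, σ, τ, hp, -, hσ, hτ, rfl⟩ := h
  rw [Finset.mul_sum, Matrix.trace_sum]
  refine Finset.sum_nonneg fun i _ => ?_
  rw [Matrix.mul_smul, Matrix.trace_smul, trace_swapMatrix_mul_kronecker, smul_eq_mul]
  exact mul_nonneg (Complex.zero_le_real.2 (hp i))
    (trace_mul_nonneg (hσ i).posSemidef (hτ i).posSemidef)

theorem trace_swapMatrix_mul_wernerState (hd : 2 ≤ d) (α : ℝ) :
    (swapMatrix d * wernerState d α).trace = (((1 - α * (d + 1)) / d : ℝ) : ℂ) := by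
  have hd0 : (d : ℂ) ≠ 0 := Nat.cast_ne_zero.2 (by omega)
  have hd1 : (d : ℂ) - 1 ≠ 0 := sub_ne_zero.2 (Nat.cast_ne_one.2 (by omega))
  rw [wernerState_eq_smul_one_sub_smul_swapMatrix, mul_sub, mul_smul_comm, mul_smul_comm, mul_one,
    swapMatrix_mul_self, Matrix.trace_sub, Matrix.trace_smul, Matrix.trace_smul, Matrix.trace_one,
    trace_swapMatrix, Fintype.card_prod, Fintype.card_fin]
  push_cast
  simp only [smul_eq_mul]
  field_simp
  ring

theorem isEntangled_wernerState (hd : 2 ≤ d) {α : ℝ} (h0 : 1 / ((d : ℝ) + 1) < α) (h1 : α ≤ 1) :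
    IsEntangled (wernerState d α) := by
  have hd0 : (0 : ℝ) < d := by exact_mod_cast (by omega : 0 < d)
  have hα : 0 < α := h0.trans' (by positivity)
  refine ⟨isState_wernerState hd hα.le h1, fun hsep => ?_⟩
  have hwitness := hsep.trace_swapMatrix_mul_nonneg
  rw [trace_swapMatrix_mul_wernerState hd, Complex.zero_le_real] at hwitness
  rw [div_lt_iff₀ (by positivity)] at h0
  exact hwitness.not_gt (div_neg_of_neg_of_pos (by linarith) hd0)

end Werner

section Threshold

variable {d : ℕ}

theorem barrettBound_pos (hd : 2 ≤ d) : 0 < barrettBound d := by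
  have hd' : (2 : ℝ) ≤ d := by exact_mod_cast hd
  have h1 : 0 < (d : ℝ) - 1 := by linarith
  have h2 : 0 < 3 * (d : ℝ) - 1 := by linarith
  unfold barrettBound
  positivity

theorem barrettBound_le_one (hd : 2 ≤ d) : barrettBound d ≤ 1 := by
  have hd' : (2 : ℝ) ≤ d := by exact_mod_cast hd
  have hd1 : (0 : ℝ) ≤ d - 1 := by linarith
  have hfrac : (3 * (d : ℝ) - 1) / (d + 1) ≤ d := by
    rw [div_le_iff₀ (by positivity)]
    nlinarith [sq_nonneg ((d : ℝ) - 1)]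
  have hpow : ((d : ℝ) - 1) ^ (d - 1) ≤ (d : ℝ) ^ (d - 1) := by
    gcongr
    linarith
  rw [barrettBound, ← div_eq_mul_inv, div_le_one (by positivity)]
  calc (3 * (d : ℝ) - 1) / (d + 1) * ((d : ℝ) - 1) ^ (d - 1)
      ≤ d * (d : ℝ) ^ (d - 1) := by gcongr
    _ = (d : ℝ) ^ d := mul_pow_sub_one (by omega) _

end Threshold

section GaussianTail

theorem integral_Ioi_mul_exp_neg_sq (b : ℝ) :
    ∫ y in Set.Ioi b, y * Real.exp (-y ^ 2) = Real.exp (-b ^ 2) / 2 := by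
  have hderiv (y : ℝ) :
      HasDerivAt (fun y : ℝ => -(Real.exp (-y ^ 2) / 2)) (y * Real.exp (-y ^ 2)) y := by
    refine ((hasDerivAt_pow 2 y).fun_neg.exp.div_const 2).fun_neg.congr_deriv ?_
    push_cast
    ring
  have hint : Integrable fun y : ℝ => y * Real.exp (-y ^ 2) := by
    simpa using integrable_mul_exp_neg_mul_sq one_pos
  have htendsto : Filter.Tendsto (fun y : ℝ => -(Real.exp (-y ^ 2) / 2)) Filter.atTop (nhds 0) := by
    simpa using ((Real.tendsto_exp_neg_atTop_nhds_zero.comp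
      (Filter.tendsto_pow_atTop two_ne_zero)).div_const 2).neg
  rw [integral_Ioi_of_hasDerivAt_of_tendsto' (fun y _ => hderiv y) hint.integrableOn htendsto,
    zero_sub, neg_neg]

variable {P : Type*} [NormedAddCommGroup P] [InnerProductSpace ℝ P] [FiniteDimensional ℝ P]
  [MeasurableSpace P] [BorelSpace P]

theorem integrable_exp_neg_norm_sq : Integrable fun x : P => Real.exp (-‖x‖ ^ 2) := by
  refine not_imp_comm.1 integral_undef ?_
  have h := GaussianFourier.integral_rexp_neg_mul_sq_norm (V := P) one_pos
  simp only [neg_mul, one_mul, div_one] at h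
  rw [h]
  positivity

theorem setIntegral_exp_neg_norm_sq_of_finrank_eq_two (hP : Module.finrank ℝ P = 2) {a : ℝ}
    (ha : 0 ≤ a) :
    ∫ z in {z : P | a < ‖z‖ ^ 2}, Real.exp (-‖z‖ ^ 2) = Real.pi * Real.exp (-a) := by
  have : Nontrivial P := Module.nontrivial_of_finrank_pos (R := ℝ) (by omega)
  have hball : volume.real (Metric.ball (0 : P) 1) = Real.pi := by
    rw [Measure.real, InnerProductSpace.volume_ball_of_dim_even (k := 1) hP]
    simp [Real.pi_nonneg]
  have hradial : ∫ y in Set.Ioi (0 : ℝ),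
        y * {y | a < y ^ 2}.indicator (fun y => Real.exp (-y ^ 2)) y =
      ∫ y in Set.Ioi √a, y * Real.exp (-y ^ 2) := by
    have hset : Set.Ioi 0 ∩ {y : ℝ | a < y ^ 2} = Set.Ioi √a := by
      ext y
      simp only [Set.mem_inter_iff, Set.mem_Ioi, Set.mem_ofPred_eq]
      exact ⟨fun h => (Real.sqrt_lt' h.1).2 h.2, fun h =>
        have h0 := (Real.sqrt_nonneg a).trans_lt h
        ⟨h0, (Real.sqrt_lt' h0).1 h⟩⟩
    simp only [← Set.indicator_mul_right _ fun y : ℝ => y]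
    rw [setIntegral_indicator (measurableSet_lt (by fun_prop) (by fun_prop)), hset]
  rw [← integral_indicator (measurableSet_lt (by fun_prop) (by fun_prop))]
  have := integral_fun_norm_addHaar (volume : Measure P)
    ({y : ℝ | a < y ^ 2}.indicator fun y => Real.exp (-y ^ 2))
  simp only [hP, hball, smul_eq_mul, Nat.add_one_sub_one, pow_one, hradial,
    integral_Ioi_mul_exp_neg_sq, Real.sq_sqrt ha, nsmul_eq_mul, Nat.cast_ofNat] at this
  refine this.trans (by ring)

end GaussianTail

section GaussianCone

variable {E P V : Type*}
  [NormedAddCommGroup E] [InnerProductSpace ℝ E] [FiniteDimensional ℝ E]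
  [MeasurableSpace E] [BorelSpace E]
  [NormedAddCommGroup P] [InnerProductSpace ℝ P] [FiniteDimensional ℝ P]
  [MeasurableSpace P] [BorelSpace P]
  [NormedAddCommGroup V] [InnerProductSpace ℝ V] [FiniteDimensional ℝ V]
  [MeasurableSpace V] [BorelSpace V]

theorem setIntegral_prod_exp_neg_norm_sq (hP : Module.finrank ℝ P = 2) {s : ℝ} (hs : 0 ≤ s) :
    ∫ p in {p : P × V | s * ‖p.2‖ ^ 2 < ‖p.1‖ ^ 2},
        Real.exp (-‖p.1‖ ^ 2) * Real.exp (-‖p.2‖ ^ 2) =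
      Real.pi * (Real.pi / (1 + s)) ^ (Module.finrank ℝ V / 2 : ℝ) := by
  have hcone : MeasurableSet {p : P × V | s * ‖p.2‖ ^ 2 < ‖p.1‖ ^ 2} :=
    measurableSet_lt (by fun_prop) (by fun_prop)
  have hsection (y : V) :
      ∫ x : P, {p : P × V | s * ‖p.2‖ ^ 2 < ‖p.1‖ ^ 2}.indicator
        (fun p => Real.exp (-‖p.1‖ ^ 2) * Real.exp (-‖p.2‖ ^ 2)) (x, y) =
      Real.pi * Real.exp (-(1 + s) * ‖y‖ ^ 2) := by
    calc _ = ∫ x in {x : P | s * ‖y‖ ^ 2 < ‖x‖ ^ 2}, Real.exp (-‖x‖ ^ 2) * Real.exp (-‖y‖ ^ 2) :=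
          integral_indicator (μ := (volume : Measure P))
            (f := fun x => Real.exp (-‖x‖ ^ 2) * Real.exp (-‖y‖ ^ 2))
            (measurableSet_lt (by fun_prop) (by fun_prop))
      _ = Real.pi * Real.exp (-(s * ‖y‖ ^ 2)) * Real.exp (-‖y‖ ^ 2) := by
          rw [integral_mul_const, setIntegral_exp_neg_norm_sq_of_finrank_eq_two hP (by positivity)]
      _ = Real.pi * Real.exp (-(1 + s) * ‖y‖ ^ 2) := by
          rw [mul_assoc, ← Real.exp_add]
          ring_nf
  rw [← integral_indicator hcone, Measure.volume_eq_prod, integral_prod_symm _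
    ((integrable_exp_neg_norm_sq.mul_prod integrable_exp_neg_norm_sq).indicator hcone)]
  simp only [hsection, integral_const_mul]
  rw [GaussianFourier.integral_rexp_neg_mul_sq_norm (by positivity)]

theorem setIntegral_cone_exp_neg_norm_sq (Φ : E ≃ₗᵢ[ℝ] WithLp 2 (P × V))
    (hP : Module.finrank ℝ P = 2) {t : ℝ} (ht0 : 0 ≤ t) (ht1 : t < 1) :
    ∫ x in {x : E | t * ‖x‖ ^ 2 < ‖(Φ x).ofLp.1‖ ^ 2}, Real.exp (-‖x‖ ^ 2) =
      Real.pi * (Real.pi * (1 - t)) ^ (Module.finrank ℝ V / 2 : ℝ) := by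
  have h1t : 0 < 1 - t := sub_pos.2 ht1
  have hmp : MeasurePreserving (fun x : E => WithLp.ofLp (Φ x)) :=
    (WithLp.volume_preserving_ofLp P V).comp Φ.measurePreserving
  have hemb : MeasurableEmbedding (fun x : E => WithLp.ofLp (Φ x)) :=
    ((Φ.toMeasurableEquiv).trans (MeasurableEquiv.toLp 2 (P × V)).symm).measurableEmbedding
  have hnorm (x : E) : ‖x‖ ^ 2 = ‖(Φ x).ofLp.1‖ ^ 2 + ‖(Φ x).ofLp.2‖ ^ 2 := by
    rw [← Φ.norm_map]
    exact WithLp.prod_norm_sq_eq_of_L2 _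
  have hcone : {x : E | t * ‖x‖ ^ 2 < ‖(Φ x).ofLp.1‖ ^ 2} =
      (fun x : E => WithLp.ofLp (Φ x)) ⁻¹' {p | t / (1 - t) * ‖p.2‖ ^ 2 < ‖p.1‖ ^ 2} := by
    ext x
    simp only [Set.mem_ofPred_eq, Set.mem_preimage, hnorm, div_mul_eq_mul_div, div_lt_iff₀ h1t]
    constructor <;> intro h <;> linarith
  have hexp (x : E) : Real.exp (-‖x‖ ^ 2) =
      Real.exp (-‖(Φ x).ofLp.1‖ ^ 2) * Real.exp (-‖(Φ x).ofLp.2‖ ^ 2) := by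
    rw [← Real.exp_add, hnorm]
    ring_nf
  have hslope : 1 + t / (1 - t) = (1 - t)⁻¹ := by
    field_simp
    ring
  simp only [hexp, hcone]
  rw [hmp.setIntegral_preimage_emb hemb
      (fun p : P × V => Real.exp (-‖p.1‖ ^ 2) * Real.exp (-‖p.2‖ ^ 2)),
    setIntegral_prod_exp_neg_norm_sq hP (by positivity), hslope, div_inv_eq_mul]

end GaussianCone

section Sphere

open scoped Pointwise

variable {E : Type*} [NormedAddCommGroup E]

section NormedSpace

variable [NormedSpace ℝ E]

/-- The action of a linear isometry on the unit sphere. -/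
def sphereMap (U : E ≃ₗᵢ[ℝ] E) (l : Metric.sphere (0 : E) 1) : Metric.sphere (0 : E) 1 :=
  ⟨U l.1, by simp⟩

theorem sphereMap_symm_sphereMap (U : E ≃ₗᵢ[ℝ] E) (l : Metric.sphere (0 : E) 1) :
    sphereMap U.symm (sphereMap U l) = l :=
  Subtype.ext (U.symm_apply_apply l.1)

theorem preimage_smul_coe_image (U : E ≃ₗᵢ[ℝ] E) (T : Set ℝ) (s : Set (Metric.sphere (0 : E) 1)) :
    U ⁻¹' (T • (Subtype.val '' s)) = T • (Subtype.val '' (sphereMap U ⁻¹' s)) := by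
  ext x
  simp only [Set.mem_smul, Set.mem_preimage, Set.exists_mem_image]
  constructor
  · rintro ⟨r, hr, l, hl, hx⟩
    refine ⟨r, hr, sphereMap U.symm l, ?_, U.injective ?_⟩
    · exact (sphereMap_symm_sphereMap U.symm l).symm ▸ hl
    · simpa [sphereMap] using hx
  · rintro ⟨r, hr, l, hl, rfl⟩
    exact ⟨r, hr, sphereMap U l, hl, by simp [sphereMap]⟩

variable [MeasurableSpace E] [BorelSpace E]

theorem integral_eq_integral_toSphere_mul_integral [FiniteDimensional ℝ E] [Nontrivial E]
    (μ : Measure E) [μ.IsAddHaarMeasure] {F : E → ℝ} {f : Metric.sphere (0 : E) 1 → ℝ} {g : ℝ → ℝ}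
    (h : ∀ (s : Metric.sphere (0 : E) 1) (r : ℝ), 0 < r → F (r • s.1) = f s * g r) :
    ∫ x, F x ∂μ = (∫ s, f s ∂μ.toSphere) *
      ∫ r : Set.Ioi (0 : ℝ), g r ∂Measure.volumeIoiPow (Module.finrank ℝ E - 1) := by
  have hF : ∫ x, F x ∂μ = ∫ x : ({0}ᶜ : Set E), F x ∂(μ.comap (↑)) := by
    rw [integral_subtype_comap (measurableSet_singleton _).compl, restrict_compl_singleton]
  rw [hF, ← integral_prod_mul f fun r : Set.Ioi (0 : ℝ) => g r,
    ← μ.measurePreserving_homeomorphUnitSphereProd.integral_comp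
      (Homeomorph.measurableEmbedding _)]
  refine integral_congr_ae (.of_forall fun x => ?_)
  refine Eq.trans (congrArg F ?_) (h _ _ (homeomorphUnitSphereProd E x).2.2)
  exact congrArg Subtype.val ((homeomorphUnitSphereProd E).symm_apply_apply x).symm

theorem setIntegral_exp_neg_norm_sq_eq_toSphere_real_mul [FiniteDimensional ℝ E] [Nontrivial E]
    (μ : Measure E) [μ.IsAddHaarMeasure] {C : Set E} (hC : MeasurableSet C)
    (hsmul : ∀ (r : ℝ) (x : E), 0 < r → (r • x ∈ C ↔ x ∈ C)) :
    ∫ x in C, Real.exp (-‖x‖ ^ 2) ∂μ = μ.toSphere.real (Subtype.val ⁻¹' C) *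
      ∫ r : Set.Ioi (0 : ℝ), Real.exp (-(r : ℝ) ^ 2)
        ∂Measure.volumeIoiPow (Module.finrank ℝ E - 1) := by
  rw [← integral_indicator hC, ← integral_indicator_one (measurable_subtype_coe hC)]
  refine integral_eq_integral_toSphere_mul_integral μ (f := (Subtype.val ⁻¹' C).indicator 1)
    (g := fun r => Real.exp (-r ^ 2)) fun l r hr => ?_
  have hnorm : ‖r • l.1‖ = r := by
    rw [norm_smul, norm_eq_of_mem_sphere, mul_one, Real.norm_of_nonneg hr.le]
  have hmem : r • l.1 ∈ C ↔ l ∈ Subtype.val ⁻¹' C := hsmul r l.1 hr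
  by_cases hl : l ∈ Subtype.val ⁻¹' C
  · rw [Set.indicator_of_mem hl, Set.indicator_of_mem (hmem.2 hl), hnorm, Pi.one_apply, one_mul]
  · rw [Set.indicator_of_notMem hl, Set.indicator_of_notMem (mt hmem.1 hl), zero_mul]

theorem measurable_sphereMap (U : E ≃ₗᵢ[ℝ] E) : Measurable (sphereMap U) :=
  ((U.continuous.comp continuous_subtype_val).subtype_mk _).measurable

theorem measurableEmbedding_sphereMap (U : E ≃ₗᵢ[ℝ] E) : MeasurableEmbedding (sphereMap U) :=
  (MeasurableEquiv.mk ⟨sphereMap U, sphereMap U.symm, sphereMap_symm_sphereMap U,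
    sphereMap_symm_sphereMap U.symm⟩ (measurable_sphereMap U)
    (measurable_sphereMap U.symm)).measurableEmbedding

theorem measurePreserving_sphereMap (μ : Measure E) {U : E ≃ₗᵢ[ℝ] E}
    (hU : MeasurePreserving U μ μ) : MeasurePreserving (sphereMap U) μ.toSphere μ.toSphere := by
  refine ⟨measurable_sphereMap U, Measure.ext fun s hs => ?_⟩
  rw [Measure.map_apply (measurable_sphereMap U) hs, μ.toSphere_apply' hs,
    μ.toSphere_apply' (measurable_sphereMap U hs), ← preimage_smul_coe_image,
    hU.measure_preimage_emb U.toHomeomorph.measurableEmbedding]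

end NormedSpace

variable [MeasurableSpace E] [BorelSpace E]

variable [InnerProductSpace ℝ E] [FiniteDimensional ℝ E]

theorem toSphere_real_univ_mul_integral_exp_neg_sq [Nontrivial E] :
    (volume : Measure E).toSphere.real Set.univ *
      ∫ r : Set.Ioi (0 : ℝ), Real.exp (-(r : ℝ) ^ 2)
        ∂Measure.volumeIoiPow (Module.finrank ℝ E - 1) =
      Real.pi ^ (Module.finrank ℝ E / 2 : ℝ) := by
  have hcone := setIntegral_exp_neg_norm_sq_eq_toSphere_real_mul (volume : Measure E)
    .univ fun _ _ _ => Iff.rfl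
  have hgauss := GaussianFourier.integral_rexp_neg_mul_sq_norm (V := E) one_pos
  simp only [neg_mul, one_mul, div_one] at hgauss
  rw [← Set.preimage_univ, ← hcone, setIntegral_univ, hgauss]

variable {P V : Type*} [NormedAddCommGroup P] [InnerProductSpace ℝ P] [FiniteDimensional ℝ P]
  [NormedAddCommGroup V] [InnerProductSpace ℝ V] [FiniteDimensional ℝ V]

theorem toSphere_real_lt_norm_sq_fst (Φ : E ≃ₗᵢ[ℝ] WithLp 2 (P × V))
    (hP : Module.finrank ℝ P = 2) {t : ℝ} (ht0 : 0 ≤ t) (ht1 : t < 1) :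
    (volume : Measure E).toSphere.real {l | t < ‖(Φ l.1).ofLp.1‖ ^ 2} =
      (volume : Measure E).toSphere.real Set.univ * (1 - t) ^ (Module.finrank ℝ V / 2 : ℝ) := by
  borelize P V
  have hcont : Continuous fun x : E => (Φ x).ofLp.1 :=
    continuous_fst.comp ((WithLp.prod_continuous_ofLp 2 P V).comp Φ.continuous)
  have hfinrank : Module.finrank ℝ E = 2 + Module.finrank ℝ V := by
    rw [Φ.toLinearEquiv.finrank_eq, (WithLp.linearEquiv 2 ℝ (P × V)).finrank_eq,
      Module.finrank_prod, hP]
  have : Nontrivial E := Module.nontrivial_of_finrank_pos (R := ℝ) (by omega)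
  have hE : (Module.finrank ℝ E / 2 : ℝ) = 1 + Module.finrank ℝ V / 2 := by
    rw [hfinrank]
    push_cast
    ring
  set C := {x : E | t * ‖x‖ ^ 2 < ‖(Φ x).ofLp.1‖ ^ 2}
  have hsmul (r : ℝ) (x : E) (hr : 0 < r) : r • x ∈ C ↔ x ∈ C := by
    rw [Set.mem_ofPred_eq, Set.mem_ofPred_eq, map_smul, WithLp.ofLp_smul, Prod.smul_fst,
      norm_smul, norm_smul, Real.norm_of_nonneg hr.le, mul_pow, mul_pow, mul_left_comm]
    exact mul_lt_mul_iff_right₀ (by positivity)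
  have hsphere : {l : Metric.sphere (0 : E) 1 | t < ‖(Φ l.1).ofLp.1‖ ^ 2} =
      Subtype.val ⁻¹' C := by
    ext l
    simp only [C, Set.mem_ofPred_eq, Set.mem_preimage, norm_eq_of_mem_sphere, one_pow, mul_one]
  have hcone := setIntegral_exp_neg_norm_sq_eq_toSphere_real_mul (volume : Measure E)
    (C := C) (measurableSet_lt (by fun_prop) (hcont.norm.pow 2).measurable) hsmul
  have htotal := toSphere_real_univ_mul_integral_exp_neg_sq (E := E)
  rw [hE, Real.rpow_add Real.pi_pos, Real.rpow_one] at htotal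
  rw [← hsphere, setIntegral_cone_exp_neg_norm_sq Φ hP ht0 ht1,
    Real.mul_rpow Real.pi_nonneg (sub_nonneg.2 ht1.le), ← mul_assoc, ← htotal, mul_right_comm]
    at hcone
  refine (mul_right_cancel₀ (fun h => ?_) hcone).symm
  rw [h, mul_zero] at htotal
  exact absurd htotal.symm (by positivity)

theorem toSphere_real_lt_norm_starProjection_sq (K : Submodule ℝ E)
    (hK : Module.finrank ℝ K = 2) {t : ℝ} (ht0 : 0 ≤ t) (ht1 : t < 1) :
    (volume : Measure E).toSphere.real {l | t < ‖K.starProjection l.1‖ ^ 2} =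
      (volume : Measure E).toSphere.real Set.univ * (1 - t) ^ (Module.finrank ℝ Kᗮ / 2 : ℝ) := by
  have h := toSphere_real_lt_norm_sq_fst K.orthogonalDecomposition hK ht0 ht1
  simp only [Submodule.orthogonalDecomposition_apply] at h
  exact h

end Sphere

section OverlapDistribution

variable {d : ℕ}

theorem real_inner_euclideanSpace (x y : EuclideanSpace ℂ (Fin d)) :
    inner ℝ x y = (inner ℂ x y).re := by
  simp [PiLp.inner_apply, Complex.inner]

theorem finrank_span_singleton_restrictScalars {v : EuclideanSpace ℂ (Fin d)} (hv : v ≠ 0) :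
    Module.finrank ℝ ((Submodule.span ℂ {v}).restrictScalars ℝ) = 2 :=
  ((LinearEquiv.toSpanNonzeroSingleton ℂ _ v hv).restrictScalars ℝ).finrank_eq.symm.trans
    Complex.finrank_real_complex

theorem norm_starProjection_span_singleton_restrictScalars_sq (v l : UnitVec d) :
    ‖((Submodule.span ℂ {v.1}).restrictScalars ℝ).starProjection l.1‖ ^ 2 = overlap v l := by
  have hproj : ((Submodule.span ℂ {v.1}).restrictScalars ℝ).starProjection l.1 =
      inner ℂ v.1 l.1 • v.1 := by
    refine Submodule.eq_starProjection_of_mem_of_inner_eq_zero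
      (Submodule.smul_mem _ _ (Submodule.mem_span_singleton_self v.1)) fun w hw => ?_
    obtain ⟨c, rfl⟩ := Submodule.mem_span_singleton.1 hw
    rw [real_inner_euclideanSpace, inner_smul_right, inner_sub_left, inner_smul_left,
      inner_conj_symm, inner_self_eq_norm_sq_to_K, norm_eq_of_mem_sphere]
    simp
  rw [hproj, norm_smul, norm_eq_of_mem_sphere, mul_one, overlap]

theorem toSphere_real_lt_overlap (v : UnitVec d) {t : ℝ} (ht0 : 0 ≤ t) (ht1 : t < 1) :
    (volume : Measure (EuclideanSpace ℂ (Fin d))).toSphere.real {l | t < overlap v l} =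
      (volume : Measure (EuclideanSpace ℂ (Fin d))).toSphere.real Set.univ *
        (1 - t) ^ (d - 1) := by
  have hK := finrank_span_singleton_restrictScalars (ne_zero_of_mem_unit_sphere v)
  have hKperp : (Module.finrank ℝ ((Submodule.span ℂ {v.1}).restrictScalars ℝ)ᗮ / 2 : ℝ) =
      (d - 1 : ℕ) := by
    have hadd := ((Submodule.span ℂ {v.1}).restrictScalars ℝ).finrank_add_finrank_orthogonal
    have hE : Module.finrank ℝ (EuclideanSpace ℂ (Fin d)) = 2 * d := by
      rw [finrank_real_of_complex, finrank_euclideanSpace_fin]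
    rw [hK, hE] at hadd
    rw [show Module.finrank ℝ ((Submodule.span ℂ {v.1}).restrictScalars ℝ)ᗮ = (d - 1) * 2 by omega]
    simp
  have h := toSphere_real_lt_norm_starProjection_sq
    ((Submodule.span ℂ {v.1}).restrictScalars ℝ) hK ht0 ht1
  simpa only [norm_starProjection_span_singleton_restrictScalars_sq, hKperp,
    Real.rpow_natCast] using h

theorem isProbabilityMeasure_uniformUnitVec (hd : d ≠ 0) :
    IsProbabilityMeasure (uniformUnitVec d) := by
  have := NeZero.mk hd
  have := NeZero.mk (Measure.toSphere_ne_zero (volume : Measure (EuclideanSpace ℂ (Fin d))))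
  exact isProbabilityMeasureSMul

theorem uniformUnitVec_real_lt_overlap (v : UnitVec d) {t : ℝ} (ht0 : 0 ≤ t) (ht1 : t < 1) :
    (uniformUnitVec d).real {l | t < overlap v l} = (1 - t) ^ (d - 1) := by
  have : Nontrivial (EuclideanSpace ℂ (Fin d)) := ⟨v.1, 0, ne_zero_of_mem_unit_sphere v⟩
  have huniv : (volume : Measure (EuclideanSpace ℂ (Fin d))).toSphere.real Set.univ ≠ 0 :=
    have := NeZero.mk (Measure.toSphere_ne_zero (volume : Measure (EuclideanSpace ℂ (Fin d))))
    measureReal_univ_ne_zero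
  rw [uniformUnitVec, measureReal_ennreal_smul_apply, ENNReal.toReal_inv, ← Measure.real,
    toSphere_real_lt_overlap v ht0 ht1, inv_mul_cancel_left₀ huniv]

theorem continuous_overlap (v : UnitVec d) : Continuous (overlap v) :=
  (continuous_const.inner continuous_subtype_val).norm.pow 2

theorem overlap_nonneg (v l : UnitVec d) : 0 ≤ overlap v l := sq_nonneg _

theorem overlap_le_one (v l : UnitVec d) : overlap v l ≤ 1 := by
  refine pow_le_one₀ (norm_nonneg _) ((norm_inner_le_norm v.1 l.1).trans_eq ?_)
  rw [norm_eq_of_mem_sphere, norm_eq_of_mem_sphere, one_mul]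

theorem identDistrib_overlap (hd : d ≠ 0) (v w : UnitVec d) :
    ProbabilityTheory.IdentDistrib (overlap v) (overlap w) (uniformUnitVec d)
      (uniformUnitVec d) := by
  have := isProbabilityMeasure_uniformUnitVec hd
  have hmeas (x : UnitVec d) : Measurable (overlap x) := (continuous_overlap x).measurable
  have htail (t : ℝ) : (uniformUnitVec d).real {l | t < overlap v l} =
      (uniformUnitVec d).real {l | t < overlap w l} := by
    rcases lt_or_ge t 0 with ht0 | ht0
    · simp only [ht0.trans_le (overlap_nonneg _ _)]
    rcases lt_or_ge t 1 with ht1 | ht1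
    · rw [uniformUnitVec_real_lt_overlap v ht0 ht1, uniformUnitVec_real_lt_overlap w ht0 ht1]
    · simp only [((overlap_le_one _ _).trans ht1).not_gt]
  refine ⟨(hmeas v).aemeasurable, (hmeas w).aemeasurable, Measure.ext_of_Iic _ _ fun t => ?_⟩
  have hcompl (x : UnitVec d) : overlap x ⁻¹' Set.Iic t = {l | t < overlap x l}ᶜ := by
    ext l
    simp
  rw [Measure.map_apply (hmeas v) measurableSet_Iic, Measure.map_apply (hmeas w) measurableSet_Iic,
    ← measureReal_eq_measureReal_iff, hcompl, hcompl,
    probReal_compl_eq_one_sub (measurableSet_lt measurable_const (hmeas v)),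
    probReal_compl_eq_one_sub (measurableSet_lt measurable_const (hmeas w)), htail]

theorem uniformUnitVec_lt_max_overlap_sub (hd : d ≠ 0) (v : UnitVec d) {s t : ℝ} (hs : 0 ≤ s)
    (ht : 0 < t) :
    uniformUnitVec d {l | t < max (overlap v l - s) 0} =
      (Set.Iio (1 - s)).indicator (fun t => ENNReal.ofReal ((1 - s - t) ^ (d - 1))) t := by
  have := isProbabilityMeasure_uniformUnitVec hd
  have hset : {l : UnitVec d | t < max (overlap v l - s) 0} = {l | s + t < overlap v l} := by
    ext l
    simp [ht.not_gt, lt_sub_iff_add_lt']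
  rw [hset, ← ofReal_measureReal]
  by_cases hst : s + t < 1
  · rw [Set.indicator_of_mem (Set.mem_Iio.2 (by linarith)),
      uniformUnitVec_real_lt_overlap v (by positivity) hst, sub_sub]
  · have hempty : {l | s + t < overlap v l} = ∅ :=
      Set.eq_empty_of_forall_notMem fun l hl => hst (hl.trans_le (overlap_le_one v l))
    rw [Set.indicator_of_notMem (fun h => hst (by linarith [Set.mem_Iio.1 h])), hempty]
    simp

theorem integral_intervalIntegral_overlap (hd : d ≠ 0) (v : UnitVec d) {s : ℝ} (hs0 : 0 ≤ s)
    (hs1 : s ≤ 1) {g : ℝ → ℝ} (hg : Continuous g) (hg0 : ∀ t, 0 ≤ t → 0 ≤ g t) :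
    ∫ l, (∫ t in 0..max (overlap v l - s) 0, g t) ∂uniformUnitVec d =
      ∫ t in 0..1 - s, (1 - s - t) ^ (d - 1) * g t := by
  have htail (t : ℝ) (ht : t ∈ Set.Ioc 0 (1 - s)) : 0 ≤ (1 - s - t) ^ (d - 1) * g t :=
    mul_nonneg (pow_nonneg (sub_nonneg.2 ht.2) _) (hg0 t ht.1.le)
  have hcont : Continuous fun x => ∫ t in 0..x, g t :=
    intervalIntegral.continuous_primitive (fun a b => hg.intervalIntegrable a b) 0
  rw [intervalIntegral.integral_of_le (sub_nonneg.2 hs1), integral_eq_lintegral_of_nonneg_ae,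
    integral_eq_lintegral_of_nonneg_ae, lintegral_comp_eq_lintegral_meas_lt_mul]
  · congr 1
    rw [setLIntegral_congr Ioo_ae_eq_Ioc.symm, ← Set.Ioi_inter_Iio, Set.inter_comm,
      ← setLIntegral_indicator measurableSet_Iio]
    refine setLIntegral_congr_fun measurableSet_Ioi fun t ht => ?_
    simp only [uniformUnitVec_lt_max_overlap_sub hd v hs0 ht, Set.indicator_apply, ite_mul,
      zero_mul]
    split_ifs with hts
    · rw [ENNReal.ofReal_mul (pow_nonneg (sub_nonneg.2 (le_of_lt hts)) _)]
    · rfl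
  · exact .of_forall fun l => le_max_right _ _
  · exact (((continuous_overlap v).sub continuous_const).max continuous_const).aemeasurable
  · exact fun t _ => hg.intervalIntegrable 0 t
  · exact (ae_restrict_iff' measurableSet_Ioi).2 (.of_forall fun t ht => hg0 t (le_of_lt ht))
  · exact (ae_restrict_iff' measurableSet_Ioc).2 (.of_forall htail)
  · exact Continuous.aestronglyMeasurable (by fun_prop)
  · exact .of_forall fun l => intervalIntegral.integral_nonneg (le_max_right _ _)
      fun t ht => hg0 t ht.1
  · exact (hcont.comp (((continuous_overlap v).sub continuous_const).max
      continuous_const)).aestronglyMeasurable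

theorem integral_overlap (hd : d ≠ 0) (v : UnitVec d) :
    ∫ l, overlap v l ∂uniformUnitVec d = (d : ℝ)⁻¹ := by
  have h := integral_intervalIntegral_overlap hd v le_rfl zero_le_one
    (g := fun _ => 1) continuous_const fun _ _ => zero_le_one
  simpa [overlap_nonneg, intervalIntegral.integral_comp_sub_left (fun t : ℝ => t ^ (d - 1)),
    Nat.cast_pred (Nat.pos_of_ne_zero hd)] using h

/-- The overlap `q` where it reaches Barrett's acceptance threshold `1 / d`, and zero below. -/
def clip (d : ℕ) (q : ℝ) : ℝ :=
  if 1 / (d : ℝ) ≤ q then q else 0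

/-- Both sides are `d x² + x` at `x = max (q - 1 / d) 0`; as a primitive, its expectation
becomes an integral of the tail of `q`. -/
theorem clip_mul_sub_one (hd : d ≠ 0) (q : ℝ) :
    clip d q * (d * q - 1) = ∫ t in 0..max (q - 1 / d) 0, (2 * d * t + 1) := by
  have hd0 : (d : ℝ) ≠ 0 := Nat.cast_ne_zero.2 hd
  have hprimitive (x : ℝ) : ∫ t in 0..x, (2 * d * t + 1) = d * x ^ 2 + x := by
    rw [intervalIntegral.integral_add (Continuous.intervalIntegrable (by fun_prop) _ _)
      intervalIntegrable_const, intervalIntegral.integral_const_mul, integral_id,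
      intervalIntegral.integral_const, smul_eq_mul]
    ring
  rw [hprimitive, clip]
  split_ifs with hq
  · rw [max_eq_left (sub_nonneg.2 hq)]
    field_simp
    ring
  · rw [max_eq_right (sub_nonpos.2 (le_of_not_ge hq))]
    ring

theorem integral_sub_pow_mul_linear (n : ℕ) (c r : ℝ) :
    ∫ t in 0..r, (r - t) ^ n * (c * t + 1) =
      r ^ (n + 1) / (n + 1) + c * r ^ (n + 2) / ((n + 1) * (n + 2)) := by
  have hderiv (t : ℝ) : HasDerivAt (fun t => -((r - t) ^ (n + 1) * (c * t + 1) / (n + 1) +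
      c * (r - t) ^ (n + 2) / ((n + 1) * (n + 2)))) ((r - t) ^ n * (c * t + 1)) t := by
    have hpow (k : ℕ) := ((hasDerivAt_id t).const_sub r).pow k
    have hlin := ((hasDerivAt_id t).const_mul c).add_const 1
    refine ((((hpow (n + 1)).mul hlin).div_const (n + 1 : ℝ)).add
      (((hpow (n + 2)).const_mul c).div_const ((n + 1) * (n + 2) : ℝ))).neg.congr_deriv ?_
    simp only [Nat.cast_add, Nat.cast_one, id_eq, add_tsub_cancel_right, mul_neg, mul_one, neg_mul,
      Pi.pow_apply, Nat.cast_ofNat, Nat.add_one_sub_one, neg_add_rev]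
    field_simp
    ring
  rw [intervalIntegral.integral_eq_sub_of_hasDerivAt (fun t _ => hderiv t)
    (Continuous.intervalIntegrable (by fun_prop) _ _)]
  simp

theorem integral_clip_overlap_mul_sub_one (hd : d ≠ 0) (v : UnitVec d) :
    ∫ l, clip d (overlap v l) * (d * overlap v l - 1) ∂uniformUnitVec d =
      barrettBound d * ((d - 1) / d) := by
  obtain ⟨m, rfl⟩ := Nat.exists_eq_add_one_of_ne_zero hd
  have hd1 : 1 / ((m + 1 : ℕ) : ℝ) ≤ 1 := by
    simpa using Nat.cast_inv_le_one (m + 1)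
  have h := integral_intervalIntegral_overlap hd v (by positivity) hd1
    (g := fun t => 2 * (m + 1 : ℕ) * t + 1) (by fun_prop) fun t ht => by positivity
  have hr : 1 - 1 / (m + 1 : ℝ) = m / (m + 1) := by
    field_simp
    ring
  simp only [clip_mul_sub_one hd, h]
  simp only [barrettBound, add_tsub_cancel_right, Nat.cast_add, Nat.cast_one,
    integral_sub_pow_mul_linear, hr, div_pow]
  field_simp
  ring

end OverlapDistribution

open scoped Matrix

section Ketbra

variable {d : ℕ}

theorem ketbra_eq_vecMulVec (v : UnitVec d) :
    ketbra v = Matrix.vecMulVec v.1.ofLp (star v.1.ofLp) := rfl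

theorem star_dotProduct_unitVec (v : UnitVec d) : star v.1.ofLp ⬝ᵥ v.1.ofLp = 1 := by
  have h : inner ℂ v.1 v.1 = 1 := by
    rw [inner_self_eq_norm_sq_to_K, norm_eq_of_mem_sphere]
    simp
  rwa [EuclideanSpace.inner_eq_star_dotProduct, dotProduct_comm] at h

theorem isStarProjection_ketbra (v : UnitVec d) : IsStarProjection (ketbra v) := by
  rw [ketbra_eq_vecMulVec]
  constructor
  · rw [IsIdempotentElem, Matrix.vecMulVec_mul_vecMulVec, star_dotProduct_unitVec]
    simp
  · rw [IsSelfAdjoint, Matrix.star_eq_conjTranspose, Matrix.conjTranspose_vecMulVec, star_star]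

theorem overlap_eq_trace (v l : UnitVec d) : (overlap v l : ℂ) = (ketbra l * ketbra v).trace := by
  have hinner (x y : UnitVec d) : inner ℂ x.1 y.1 = star x.1.ofLp ⬝ᵥ y.1.ofLp := by
    rw [EuclideanSpace.inner_eq_star_dotProduct, dotProduct_comm]
  rw [overlap, Complex.ofReal_pow, ← Complex.mul_conj', inner_conj_symm, hinner, hinner,
    ketbra_eq_vecMulVec, ketbra_eq_vecMulVec, Matrix.vecMulVec_mul_vecMulVec,
    Matrix.trace_vecMulVec, dotProduct_smul, smul_eq_mul, mul_comm,
    dotProduct_comm l.1.ofLp]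

theorem isState_ketbra (v : UnitVec d) : IsState (ketbra v) where
  posSemidef := posSemidef_of_isStarProjection (isStarProjection_ketbra v)
  trace_eq_one := by
    rw [ketbra_eq_vecMulVec, Matrix.trace_vecMulVec, dotProduct_comm, star_dotProduct_unitVec]

theorem continuous_ketbra_apply (i j : Fin d) : Continuous fun l : UnitVec d => ketbra l i j := by
  have h (k : Fin d) : Continuous fun l : UnitVec d => l.1 k := by fun_prop
  exact (h i).mul (h j).star

theorem isStateFamily_ketbra : IsStateFamily (ketbra (d := d)) where
  measurable i j := (continuous_ketbra_apply i j).measurable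
  isState := isState_ketbra

theorem isState_hiddenState (hd : 2 ≤ d) (l : UnitVec d) : IsState (hiddenState d l) := by
  have hd1 : (0 : ℝ) < d - 1 := sub_pos.2 (by exact_mod_cast hd)
  constructor
  · rw [hiddenState, ← Complex.ofReal_inv]
    exact (posSemidef_of_isStarProjection (isStarProjection_ketbra l).one_sub).smul
      (Complex.zero_le_real.2 (inv_pos.2 hd1).le)
  · have hd1' : (d : ℂ) - 1 ≠ 0 := by exact_mod_cast hd1.ne'
    rw [hiddenState, Matrix.trace_smul, Matrix.trace_sub, Matrix.trace_one,
      (isState_ketbra l).trace_eq_one, Fintype.card_fin, smul_eq_mul]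
    push_cast
    exact inv_mul_cancel₀ hd1'

theorem isStateFamily_hiddenState (hd : 2 ≤ d) : IsStateFamily (hiddenState d) where
  measurable i j :=
    (continuous_const.mul (continuous_const.sub (continuous_ketbra_apply i j))).measurable
  isState := isState_hiddenState hd

end Ketbra

section UnitaryInvariance

variable {d : ℕ}

/-- The action of a unitary matrix on the unit vectors of `ℂ^d`. -/
def unitaryAction (U : Matrix.unitaryGroup (Fin d) ℂ) : UnitVec d → UnitVec d :=
  let e : EuclideanSpace ℂ (Fin d) ≃ₗᵢ[ℂ] EuclideanSpace ℂ (Fin d) :=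
    Unitary.linearIsometryEquiv ⟨Matrix.toEuclideanCLM (𝕜 := ℂ) U.1,
      Unitary.map_mem (Matrix.toEuclideanCLM (𝕜 := ℂ)) U.2⟩
  sphereMap ⟨e.toLinearEquiv.restrictScalars ℝ, e.norm_map⟩

theorem ketbra_unitaryAction (U : Matrix.unitaryGroup (Fin d) ℂ) (l : UnitVec d) :
    ketbra (unitaryAction U l) = U.1 * ketbra l * star U.1 := by
  have h : (unitaryAction U l).1.ofLp = U.1 *ᵥ l.1.ofLp := rfl
  rw [ketbra_eq_vecMulVec, ketbra_eq_vecMulVec, h, Matrix.mul_vecMulVec, Matrix.vecMulVec_mul,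
    Matrix.star_mulVec, Matrix.star_eq_conjTranspose]

theorem overlap_unitaryAction {U : Matrix.unitaryGroup (Fin d) ℂ} {v : UnitVec d}
    (hU : Commute U.1 (ketbra v)) (l : UnitVec d) :
    overlap v (unitaryAction U l) = overlap v l := by
  have hconj : star U.1 * ketbra v * U.1 = ketbra v := by
    rw [Matrix.mul_assoc, ← hU.eq, ← Matrix.mul_assoc, Unitary.coe_star_mul_self, one_mul]
  rw [← Complex.ofReal_inj, overlap_eq_trace, overlap_eq_trace, ketbra_unitaryAction,
    Matrix.mul_assoc, Matrix.trace_mul_comm, ← Matrix.mul_assoc, Matrix.trace_mul_comm, hconj]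

theorem integral_comp_unitaryAction (U : Matrix.unitaryGroup (Fin d) ℂ) (f : UnitVec d → ℂ) :
    ∫ l, f (unitaryAction U l) ∂uniformUnitVec d = ∫ l, f l ∂uniformUnitVec d := by
  unfold unitaryAction uniformUnitVec
  exact ((measurePreserving_sphereMap volume (LinearIsometryEquiv.measurePreserving _)).smul_measure
    _).integral_comp (measurableEmbedding_sphereMap _) f

theorem commute_mixture_ketbra {U : Matrix.unitaryGroup (Fin d) ℂ} {f : UnitVec d → ℝ}
    (hf : Integrable f (uniformUnitVec d)) (hU : ∀ l, f (unitaryAction U l) = f l) :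
    Commute (mixture (uniformUnitVec d) ketbra f) U.1 := by
  set T := mixture (uniformUnitVec d) ketbra f
  have hconj : U.1 * T * star U.1 = T := by
    refine Matrix.ext_iff_trace_mul_right.2 fun B => ?_
    have hcycle (X : Matrix (Fin d) (Fin d) ℂ) :
        (U.1 * X * star U.1 * B).trace = (X * (star U.1 * B * U.1)).trace := by
      rw [Matrix.mul_assoc, Matrix.mul_assoc, Matrix.trace_mul_comm, Matrix.mul_assoc]
    calc (U.1 * T * star U.1 * B).trace
        = ∫ l, (f l : ℂ) * (ketbra l * (star U.1 * B * U.1)).trace ∂uniformUnitVec d := by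
          rw [hcycle, trace_mixture_mul isStateFamily_ketbra hf]
      _ = ∫ l, (f (unitaryAction U l) : ℂ) * (ketbra (unitaryAction U l) * B).trace
            ∂uniformUnitVec d := by
          simp only [hU, ketbra_unitaryAction, hcycle]
      _ = (T * B).trace := by
          rw [integral_comp_unitaryAction U fun l => (f l : ℂ) * (ketbra l * B).trace,
            trace_mixture_mul isStateFamily_ketbra hf]
  calc T * U.1 = U.1 * T * (star U.1 * U.1) := by rw [← Matrix.mul_assoc, hconj]
    _ = U.1 * T := by rw [Unitary.coe_star_mul_self, mul_one]

theorem commute_mixture_ketbra_comp_overlap {v u : UnitVec d} {h : ℝ → ℝ}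
    (hh : Integrable (fun l => h (overlap v l)) (uniformUnitVec d))
    (hvu : Commute (ketbra v) (ketbra u)) :
    Commute (mixture (uniformUnitVec d) ketbra fun l => h (overlap v l)) (ketbra u) := by
  -- `|u⟩⟨u|` is an affine function of the reflection `2 |u⟩⟨u| - 1`, which is unitary.
  let U : Matrix.unitaryGroup (Fin d) ℂ :=
    ⟨2 * ketbra u - 1, (isStarProjection_ketbra u).two_mul_sub_one_mem_unitary⟩
  have hU : Commute U.1 (ketbra v) :=
    (((Commute.ofNat_left 2 _).mul_left hvu.symm).sub_left (Commute.one_left _))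
  have hT := commute_mixture_ketbra hh fun l => congrArg h (overlap_unitaryAction hU l)
  have hketbra : ketbra u = (2⁻¹ : ℂ) • (U.1 + 1) := by
    change _ = _ • (2 * _ - 1 + 1)
    rw [sub_add_cancel, two_mul, ← two_smul ℂ, inv_smul_smul₀ two_ne_zero]
  rw [hketbra]
  exact (hT.add_right (Commute.one_right _)).smul_right _

theorem exists_mulVec_eq_smul {u : UnitVec d} {T : Matrix (Fin d) (Fin d) ℂ}
    (hT : Commute T (ketbra u)) : ∃ c : ℂ, T *ᵥ u.1.ofLp = c • u.1.ofLp := by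
  have hu : ketbra u *ᵥ u.1.ofLp = u.1.ofLp := by
    rw [ketbra_eq_vecMulVec, Matrix.vecMulVec_mulVec, star_dotProduct_unitVec]
    simp
  refine ⟨star u.1.ofLp ⬝ᵥ T *ᵥ u.1.ofLp, ?_⟩
  calc T *ᵥ u.1.ofLp = ketbra u *ᵥ (T *ᵥ u.1.ofLp) := by
        rw [Matrix.mulVec_mulVec, ← hT.eq, ← Matrix.mulVec_mulVec, hu]
    _ = _ := by rw [ketbra_eq_vecMulVec, Matrix.vecMulVec_mulVec, op_smul_eq_smul]

theorem exists_mulVec_eq_smul_of_orthogonal {v : UnitVec d} {T : Matrix (Fin d) (Fin d) ℂ}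
    (hT : ∀ u, Commute (ketbra v) (ketbra u) → Commute T (ketbra u)) {x : Fin d → ℂ}
    (hx : ketbra v *ᵥ x = 0) : ∃ c : ℂ, T *ᵥ x = c • x := by
  rcases eq_or_ne x 0 with rfl | hx0
  · exact ⟨0, by simp⟩
  have hnorm : ‖WithLp.toLp 2 x‖ ≠ 0 := by simpa using hx0
  let u : UnitVec d := ⟨(‖WithLp.toLp 2 x‖⁻¹ : ℂ) • WithLp.toLp 2 x, by simp [norm_smul, hnorm]⟩
  have hxu : x = (‖WithLp.toLp 2 x‖ : ℂ) • u.1.ofLp := by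
    simp [u, hnorm]
  have hvu : ketbra v * ketbra u = 0 := by
    rw [ketbra_eq_vecMulVec u, Matrix.mul_vecMulVec]
    simp [u, Matrix.mulVec_smul, hx]
  have huv : ketbra u * ketbra v = 0 := by
    have := congrArg star hvu
    rwa [star_mul, (isStarProjection_ketbra u).isSelfAdjoint.star_eq,
      (isStarProjection_ketbra v).isSelfAdjoint.star_eq, star_zero] at this
  obtain ⟨c, hc⟩ := exists_mulVec_eq_smul (hT u (hvu.trans huv.symm))
  exact ⟨c, by rw [hxu, Matrix.mulVec_smul, hc, smul_comm]⟩

theorem exists_forall_mulVec_eq_smul {v : UnitVec d} {T : Matrix (Fin d) (Fin d) ℂ}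
    (hT : ∀ u, Commute (ketbra v) (ketbra u) → Commute T (ketbra u)) :
    ∃ c : ℂ, ∀ x, ketbra v *ᵥ x = 0 → T *ᵥ x = c • x := by
  let L := LinearMap.ker (ketbra v).mulVecLin
  have hL : ∀ x ∈ L, T.mulVecLin x ∈ L := fun x hx => by
    rw [LinearMap.mem_ker, Matrix.mulVecLin_apply] at hx ⊢
    rw [Matrix.mulVecLin_apply, Matrix.mulVec_mulVec, ← (hT v (Commute.refl _)).eq,
      ← Matrix.mulVec_mulVec, hx, Matrix.mulVec_zero]
  obtain ⟨c, hc⟩ := (T.mulVecLin.restrict hL).exists_eq_smul_id_of_forall_notLinearIndependent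
    fun x hlin => by
      obtain ⟨b, hb⟩ := exists_mulVec_eq_smul_of_orthogonal hT x.2
      exact (LinearIndependent.pair_iff' (hlin.ne_zero 0)).1 hlin b (Subtype.ext hb.symm)
  exact ⟨c, fun x hx => congrArg Subtype.val (LinearMap.congr_fun hc ⟨x, hx⟩)⟩

theorem exists_eq_smul_ketbra_add_smul_one {v : UnitVec d} {T : Matrix (Fin d) (Fin d) ℂ}
    (hT : ∀ u, Commute (ketbra v) (ketbra u) → Commute T (ketbra u)) :
    ∃ a b : ℂ, T = a • ketbra v + b • 1 := by
  obtain ⟨a, ha⟩ := exists_mulVec_eq_smul (hT v (Commute.refl _))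
  obtain ⟨b, hb⟩ := exists_forall_mulVec_eq_smul hT
  have hker : T * (1 - ketbra v) = b • (1 - ketbra v) := by
    refine Matrix.ext_of_mulVec_single fun i => ?_
    rw [← Matrix.mulVec_mulVec, Matrix.smul_mulVec]
    apply hb
    rw [Matrix.mulVec_mulVec, (isStarProjection_ketbra v).isIdempotentElem.mul_one_sub_self,
      Matrix.zero_mulVec]
  have hrange : T * ketbra v = a • ketbra v := by
    rw [ketbra_eq_vecMulVec, Matrix.mul_vecMulVec, ha, Matrix.smul_vecMulVec]
  refine ⟨a - b, b, ?_⟩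
  calc T = T * ketbra v + T * (1 - ketbra v) := by rw [← mul_add, add_sub_cancel, mul_one]
    _ = (a - b) • ketbra v + b • 1 := by rw [hrange, hker]; module

theorem mixture_ketbra_comp_overlap (hd : 2 ≤ d) (v : UnitVec d) {h : ℝ → ℝ}
    (hh : Integrable (fun l => h (overlap v l)) (uniformUnitVec d)) {A : ℝ}
    (hA : ∫ l, h (overlap v l) * (d * overlap v l - 1) ∂uniformUnitVec d = A * (d - 1)) :
    mixture (uniformUnitVec d) ketbra (fun l => h (overlap v l)) =
      (A : ℂ) • ketbra v +
        (((∫ l, h (overlap v l) ∂uniformUnitVec d) - A) / d : ℂ) • 1 := by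
  have hd0 : (d : ℂ) ≠ 0 := by norm_cast; omega
  have hd1 : (d : ℂ) - 1 ≠ 0 := by rw [sub_ne_zero]; norm_cast; omega
  obtain ⟨a, b, hab⟩ := exists_eq_smul_ketbra_add_smul_one fun u =>
    commute_mixture_ketbra_comp_overlap (u := u) hh
  have ha : a = A := by
    have h1 := trace_mixture_mul isStateFamily_ketbra hh ((d : ℂ) • ketbra v - 1)
    have h2 (l : UnitVec d) : (h (overlap v l) : ℂ) * (ketbra l * ((d : ℂ) • ketbra v - 1)).trace =
        ((h (overlap v l) * (d * overlap v l - 1) : ℝ) : ℂ) := by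
      rw [mul_sub, mul_one, Matrix.mul_smul, Matrix.trace_sub, Matrix.trace_smul,
        ← overlap_eq_trace, (isState_ketbra l).trace_eq_one]
      push_cast
      rfl
    have h3 : ((a • ketbra v + b • 1) * ((d : ℂ) • ketbra v - 1)).trace = a * (d - 1) := by
      simp only [mul_sub, Matrix.mul_smul, add_mul, Matrix.smul_mul, one_mul, mul_one,
        (isStarProjection_ketbra v).isIdempotentElem.eq, Matrix.trace_sub, Matrix.trace_add,
        Matrix.trace_smul, (isState_ketbra v).trace_eq_one, Matrix.trace_one, Fintype.card_fin,
        smul_eq_mul]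
      ring
    simp only [h2, integral_complex_ofReal, hA, hab, h3] at h1
    push_cast at h1
    exact mul_right_cancel₀ hd1 h1
  have hb : a + b * d = ((∫ l, h (overlap v l) ∂uniformUnitVec d : ℝ) : ℂ) := by
    rw [← trace_mixture isStateFamily_ketbra hh, hab]
    simp [(isState_ketbra v).trace_eq_one]
  rw [hab, ← hb, ha, add_sub_cancel_left, mul_div_cancel_right₀ b hd0]

end UnitaryInvariance

section HiddenStateMixtures

variable {d : ℕ}

theorem mixture_hiddenState {f : UnitVec d → ℝ} (hf : Integrable f (uniformUnitVec d)) :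
    mixture (uniformUnitVec d) (hiddenState d) f = (((d : ℝ) - 1 : ℝ) : ℂ)⁻¹ •
      (((∫ l, f l ∂uniformUnitVec d : ℝ) : ℂ) • 1 - mixture (uniformUnitVec d) ketbra f) := by
  ext i j
  have hint : Integrable (fun l => (f l : ℂ) * (1 : Matrix (Fin d) (Fin d) ℂ) i j)
      (uniformUnitVec d) := hf.ofReal.mul_const _
  simp only [mixture, hiddenState, Matrix.of_apply, Matrix.smul_apply, Matrix.sub_apply,
    smul_eq_mul, mul_left_comm _ (_ : ℂ)⁻¹, integral_const_mul, mul_sub (f _ : ℂ)]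
  congr 1
  refine (integral_sub hint (isStateFamily_ketbra.integrable_mul hf i j)).trans ?_
  congr 1
  exact (integral_mul_const _ _).trans (congrArg (· * _) integral_complex_ofReal)

theorem mixture_hiddenState_comp_overlap (hd : 2 ≤ d) (v : UnitVec d) {h : ℝ → ℝ}
    (hh : Integrable (fun l => h (overlap v l)) (uniformUnitVec d)) {A : ℝ}
    (hA : ∫ l, h (overlap v l) * (d * overlap v l - 1) ∂uniformUnitVec d = A * (d - 1)) :
    mixture (uniformUnitVec d) (hiddenState d) (fun l => h (overlap v l)) =
      ((∫ l, h (overlap v l) ∂uniformUnitVec d : ℝ) / d : ℂ) • 1 -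
        (A / (d - 1) : ℂ) • (ketbra v - (1 / d : ℂ) • 1) := by
  have hd0 : (d : ℂ) ≠ 0 := by norm_cast; omega
  have hd1 : (d : ℂ) - 1 ≠ 0 := by rw [sub_ne_zero]; norm_cast; omega
  rw [mixture_hiddenState hh, mixture_ketbra_comp_overlap hd v hh hA]
  push_cast
  match_scalars
  · field_simp
    ring
  · field_simp

theorem integrable_overlap (hd : d ≠ 0) (v : UnitVec d) :
    Integrable (overlap v) (uniformUnitVec d) := by
  have := isProbabilityMeasure_uniformUnitVec hd
  refine .of_bound (continuous_overlap v).measurable.aestronglyMeasurable 1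
    (.of_forall fun l => ?_)
  rw [Real.norm_of_nonneg (overlap_nonneg v l)]
  exact overlap_le_one v l

theorem mixture_hiddenState_one (hd : 2 ≤ d) :
    mixture (uniformUnitVec d) (hiddenState d) (fun _ => 1) = (1 / d : ℂ) • 1 := by
  have hd0 : d ≠ 0 := by omega
  have := isProbabilityMeasure_uniformUnitVec hd0
  let v : UnitVec d := ⟨EuclideanSpace.single ⟨0, by omega⟩ 1, by simp⟩
  have hA : ∫ l, (1 : ℝ) * (d * overlap v l - 1) ∂uniformUnitVec d = 0 * (d - 1) := by
    simp only [one_mul]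
    rw [integral_sub ((integrable_overlap hd0 v).const_mul _) (integrable_const 1),
      integral_const_mul, integral_overlap hd0, integral_const, probReal_univ, one_smul,
      mul_inv_cancel₀ (Nat.cast_ne_zero.2 hd0), sub_self, zero_mul]
  simpa using mixture_hiddenState_comp_overlap hd v (h := fun _ => 1) (integrable_const 1) hA

theorem clip_nonneg {q : ℝ} (hq : 0 ≤ q) : 0 ≤ clip d q := by
  unfold clip
  split_ifs
  exacts [hq, le_rfl]

theorem clip_le_self {q : ℝ} (hq : 0 ≤ q) : clip d q ≤ q := by
  unfold clip
  split_ifs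
  exacts [le_rfl, hq]

theorem measurable_clip (d : ℕ) : Measurable (clip d) :=
  Measurable.ite measurableSet_Ici measurable_id measurable_const

theorem integrable_clip_overlap (hd : d ≠ 0) (v : UnitVec d) :
    Integrable (fun l => clip d (overlap v l)) (uniformUnitVec d) :=
  (integrable_overlap hd v).mono' ((measurable_clip d).comp
    (continuous_overlap v).measurable).aestronglyMeasurable (.of_forall fun l => by
      rw [Real.norm_of_nonneg (clip_nonneg (overlap_nonneg v l))]
      exact clip_le_self (overlap_nonneg v l))

theorem exists_integral_clip_overlap_eq (hd : d ≠ 0) :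
    ∃ I : ℝ, ∀ v : UnitVec d, ∫ l, clip d (overlap v l) ∂uniformUnitVec d = I := by
  rcases isEmpty_or_nonempty (UnitVec d) with _ | ⟨⟨w⟩⟩
  · exact ⟨0, isEmptyElim⟩
  · exact ⟨_, fun v => ((identDistrib_overlap hd v w).comp (measurable_clip d)).integral_eq⟩

theorem mixture_hiddenState_clip_overlap (hd : 2 ≤ d) (v : UnitVec d) :
    mixture (uniformUnitVec d) (hiddenState d) (fun l => clip d (overlap v l)) =
      ((∫ l, clip d (overlap v l) ∂uniformUnitVec d : ℝ) / d : ℂ) • 1 -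
        (barrettBound d / (d * (d - 1)) : ℂ) • (ketbra v - (1 / d : ℂ) • 1) := by
  have hd0 : d ≠ 0 := by omega
  rw [mixture_hiddenState_comp_overlap hd v (integrable_clip_overlap hd0 v)
    (A := barrettBound d / d) (by rw [integral_clip_overlap_mul_sub_one hd0 v]; ring)]
  push_cast
  rw [div_div]

end HiddenStateMixtures

theorem eq_sum_eigenvalues_smul_ketbra {d : ℕ} {A : Matrix (Fin d) (Fin d) ℂ}
    (hA : A.IsHermitian) : A = ∑ k, (hA.eigenvalues k : ℂ) •
      ketbra ⟨hA.eigenvectorBasis k, by simp⟩ := by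
  conv_lhs => rw [hA.spectral_theorem]
  ext i j
  rw [Unitary.conjStarAlgAut_apply, Matrix.sum_apply, Matrix.mul_apply]
  refine Finset.sum_congr rfl fun k _ => ?_
  rw [Matrix.mul_diagonal]
  simp only [Matrix.IsHermitian.eigenvectorUnitary_apply, Complex.coe_algebraMap,
    Function.comp_apply, Matrix.star_apply, RCLike.star_def, ketbra, Matrix.smul_apply,
    Matrix.of_apply, smul_eq_mul]
  ring

theorem nonempty_rankOneRefinement {d n : ℕ} (M : POVM (Fin d) n) :
    Nonempty (RankOneRefinement M) := by
  let H := fun a => (M.posSemidef a).isHermitian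
  let e := finProdFinEquiv (m := n) (n := d)
  refine ⟨{ size := n * d
            weight := fun k => (H (e.symm k).1).eigenvalues (e.symm k).2
            weight_nonneg := fun k => (M.posSemidef _).eigenvalues_nonneg _
            vec := fun k => ⟨(H (e.symm k).1).eigenvectorBasis (e.symm k).2, by simp⟩
            label := fun k => (e.symm k).1
            elem_eq := fun a => ?_ }⟩
  rw [Finset.sum_filter, ← e.sum_comp, Fintype.sum_prod_type, Finset.sum_eq_single a]
  · simp only [Equiv.symm_apply_apply, if_true]
    exact eq_sum_eigenvalues_smul_ketbra (H a)
  · intro b _ hb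
    simp [hb]
  · simp

namespace RankOneRefinement

variable {d n : ℕ} {M : POVM (Fin d) n}

theorem sum_weight_smul_ketbra (R : RankOneRefinement M) :
    ∑ k, (R.weight k : ℂ) • ketbra (R.vec k) = 1 := by
  rw [← M.sum_eq_one, ← Finset.sum_fiberwise _ R.label]
  exact Finset.sum_congr rfl fun a _ => (R.elem_eq a).symm

theorem trace_elem (R : RankOneRefinement M) (a : Fin n) :
    (M.elem a).trace = ((∑ k with R.label k = a, R.weight k : ℝ) : ℂ) := by
  rw [R.elem_eq, Matrix.trace_sum, Complex.ofReal_sum]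
  simp only [Matrix.trace_smul, (isState_ketbra _).trace_eq_one, smul_eq_mul, mul_one]

theorem sum_weight (R : RankOneRefinement M) : ∑ k, R.weight k = d := by
  have h := congrArg Matrix.trace R.sum_weight_smul_ketbra
  simp only [Matrix.trace_sum, Matrix.trace_smul, (isState_ketbra _).trace_eq_one, smul_eq_mul,
    mul_one, Matrix.trace_one, Fintype.card_fin] at h
  exact_mod_cast h

theorem sum_weight_mul_overlap (R : RankOneRefinement M) (l : UnitVec d) :
    ∑ k, R.weight k * overlap (R.vec k) l = 1 := by
  have h := congrArg (fun X => (ketbra l * X).trace) R.sum_weight_smul_ketbra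
  simp only [Finset.mul_sum, Matrix.trace_sum, Matrix.mul_smul, Matrix.trace_smul,
    ← overlap_eq_trace, mul_one, (isState_ketbra l).trace_eq_one, smul_eq_mul] at h
  exact_mod_cast h

theorem clipped_eq (R : RankOneRefinement M) (k : Fin R.size) :
    R.clipped k = fun l => R.weight k * clip d (overlap (R.vec k) l) := by
  funext l
  rw [clipped, clip, mul_ite, mul_zero]

theorem clipped_nonneg (R : RankOneRefinement M) (k : Fin R.size) (l : UnitVec d) :
    0 ≤ R.clipped k l := by
  rw [clipped_eq]
  exact mul_nonneg (R.weight_nonneg k) (clip_nonneg (overlap_nonneg _ _))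

theorem sum_clipped_le_one (R : RankOneRefinement M) (l : UnitVec d) :
    ∑ k, R.clipped k l ≤ 1 := by
  rw [← R.sum_weight_mul_overlap l]
  refine Finset.sum_le_sum fun k _ => ?_
  rw [clipped_eq]
  exact mul_le_mul_of_nonneg_left (clip_le_self (overlap_nonneg _ _)) (R.weight_nonneg k)

theorem measurable_clipped (R : RankOneRefinement M) (k : Fin R.size) :
    Measurable (R.clipped k) := by
  rw [clipped_eq]
  exact ((measurable_clip d).comp (continuous_overlap _).measurable).const_mul _

theorem integrable_clipped (hd : d ≠ 0) (R : RankOneRefinement M) (k : Fin R.size) :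
    Integrable (R.clipped k) (uniformUnitVec d) := by
  rw [clipped_eq]
  exact (integrable_clip_overlap hd _).const_mul _

theorem integrable_sum_clipped (hd : d ≠ 0) (R : RankOneRefinement M) (s : Finset (Fin R.size)) :
    Integrable (fun l => ∑ k ∈ s, R.clipped k l) (uniformUnitVec d) :=
  integrable_finsetSum s fun k _ => R.integrable_clipped hd k

theorem response_eq (R : RankOneRefinement M) (a : Fin n) :
    R.response a = fun l => ∑ k with R.label k = a, R.clipped k l +
      R.noise a * (1 - ∑ k, R.clipped k l) := by
  funext l
  rw [response, noise, Finset.sum_add_distrib, Finset.sum_mul]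

theorem integrable_response (hd : d ≠ 0) (R : RankOneRefinement M) (a : Fin n) :
    Integrable (R.response a) (uniformUnitVec d) := by
  have := isProbabilityMeasure_uniformUnitVec hd
  rw [response_eq]
  exact (R.integrable_sum_clipped hd _).add
    (((integrable_const 1).sub (R.integrable_sum_clipped hd _)).const_mul _)

theorem measurable_response (R : RankOneRefinement M) (a : Fin n) :
    Measurable (R.response a) := by
  rw [response_eq]
  exact (Finset.measurable_fun_sum _ fun k _ => R.measurable_clipped k).add
    ((measurable_const.sub (Finset.measurable_fun_sum _ fun k _ =>
      R.measurable_clipped k)).const_mul _)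

theorem noise_nonneg (R : RankOneRefinement M) (a : Fin n) : 0 ≤ R.noise a :=
  Finset.sum_nonneg fun k _ => div_nonneg (R.weight_nonneg k) (Nat.cast_nonneg _)

theorem sum_noise (hd : d ≠ 0) (R : RankOneRefinement M) : ∑ a, R.noise a = 1 := by
  simp only [noise]
  rw [Finset.sum_fiberwise, ← Finset.sum_div, R.sum_weight, div_self (Nat.cast_ne_zero.2 hd)]

theorem response_nonneg (R : RankOneRefinement M) (a : Fin n) (l : UnitVec d) :
    0 ≤ R.response a l := by
  rw [response_eq]
  exact add_nonneg (Finset.sum_nonneg fun k _ => R.clipped_nonneg k l)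
    (mul_nonneg (R.noise_nonneg a) (sub_nonneg.2 (R.sum_clipped_le_one l)))

theorem sum_response (hd : d ≠ 0) (R : RankOneRefinement M) (l : UnitVec d) :
    ∑ a, R.response a l = 1 := by
  simp only [response_eq]
  rw [Finset.sum_add_distrib, ← Finset.sum_mul, R.sum_noise hd, Finset.sum_fiberwise, one_mul,
    add_sub_cancel]

theorem quantumResponse_eq_trace (R : RankOneRefinement M) (a : Fin n) (l : UnitVec d) :
    (R.quantumResponse a l : ℂ) = (hiddenState d l * M.elem a).trace := by
  rw [R.elem_eq, Finset.mul_sum, Matrix.trace_sum, quantumResponse, Complex.ofReal_sum]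
  refine Finset.sum_congr rfl fun k _ => ?_
  rw [Matrix.mul_smul, Matrix.trace_smul, hiddenState, Matrix.smul_mul, Matrix.trace_smul, sub_mul,
    one_mul, Matrix.trace_sub, (isState_ketbra _).trace_eq_one, ← overlap_eq_trace, smul_eq_mul,
    smul_eq_mul]
  push_cast
  ring

theorem mixture_hiddenState_sum_clipped (hd : 2 ≤ d) (R : RankOneRefinement M) {I : ℝ}
    (hI : ∀ v : UnitVec d, ∫ l, clip d (overlap v l) ∂uniformUnitVec d = I)
    (s : Finset (Fin R.size)) :
    mixture (uniformUnitVec d) (hiddenState d) (fun l => ∑ k ∈ s, R.clipped k l) =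
      (I / d * ∑ k ∈ s, (R.weight k : ℂ)) • 1 - (barrettBound d / (d * (d - 1)) : ℂ) •
        (∑ k ∈ s, (R.weight k : ℂ) • ketbra (R.vec k) -
          ((∑ k ∈ s, (R.weight k : ℂ)) / d : ℂ) • 1) := by
  have hk (k : Fin R.size) : mixture (uniformUnitVec d) (hiddenState d) (R.clipped k) =
      (R.weight k : ℂ) • ((I / d : ℂ) • 1 - (barrettBound d / (d * (d - 1)) : ℂ) •
        (ketbra (R.vec k) - (1 / d : ℂ) • 1)) := by
    rw [clipped_eq, mixture_const_mul, mixture_hiddenState_clip_overlap hd, hI]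
  rw [mixture_sum (isStateFamily_hiddenState hd) fun k _ => R.integrable_clipped (by omega) k]
  simp only [hk, smul_sub, Finset.sum_sub_distrib, smul_smul, Finset.smul_sum, ← Finset.sum_smul,
    mul_comm (R.weight _ : ℂ)]
  simp only [← Finset.mul_sum, div_eq_mul_inv, one_mul, mul_comm, mul_assoc,
    mul_left_comm]

theorem noise_eq (R : RankOneRefinement M) (a : Fin n) :
    (R.noise a : ℂ) = (M.elem a).trace / d := by
  rw [noise, R.trace_elem, ← Finset.sum_div]
  push_cast
  rfl

theorem mixture_hiddenState_response (hd : 2 ≤ d) (R : RankOneRefinement M) (a : Fin n) :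
    mixture (uniformUnitVec d) (hiddenState d) (R.response a) =
      ((M.elem a).trace / d ^ 2 : ℂ) • 1 - (barrettBound d / (d * (d - 1)) : ℂ) •
        (M.elem a - ((M.elem a).trace / d : ℂ) • 1) := by
  have := isProbabilityMeasure_uniformUnitVec (d := d) (by omega)
  have hd0 : (d : ℂ) ≠ 0 := by norm_cast; omega
  have hint := R.integrable_sum_clipped (by omega)
  obtain ⟨I, hI⟩ := exists_integral_clip_overlap_eq (d := d) (by omega)
  have hsub : Integrable (fun l => 1 - ∑ k, R.clipped k l) (uniformUnitVec d) :=
    (integrable_const 1).sub (hint _)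
  have hσ := isStateFamily_hiddenState hd
  have htotal : mixture (uniformUnitVec d) (hiddenState d) (fun l => ∑ k, R.clipped k l) =
      (I : ℂ) • 1 := by
    have hw : ∑ k, (R.weight k : ℂ) = d := by exact_mod_cast R.sum_weight
    rw [R.mixture_hiddenState_sum_clipped hd hI, R.sum_weight_smul_ketbra, hw, div_self hd0,
      div_mul_cancel₀ _ hd0, one_smul, sub_self, smul_zero, sub_zero]
  rw [response_eq, mixture_add hσ (hint _) (hsub.const_mul _),
    mixture_const_mul, mixture_sub hσ (integrable_const 1) (hint _), htotal,
    mixture_hiddenState_one hd, R.mixture_hiddenState_sum_clipped hd hI, ← R.elem_eq,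
    ← Complex.ofReal_sum, ← R.trace_elem, R.noise_eq]
  module

end RankOneRefinement

section BarrettModel

variable {d : ℕ} {α : ℝ}

theorem isResponse_barrettResponse (hd : 2 ≤ d) (hα₀ : 0 ≤ α) (hα : α ≤ barrettBound d)
    (R : (n : ℕ) → (M : POVM (Fin d) n) → RankOneRefinement M) :
    IsResponse (barrettResponse α R) where
  measurable n M a := (((R n M).measurable_response a).const_mul _).add_const _
  nonneg n M a l := by
    have hb := barrettBound_pos hd
    exact add_nonneg (mul_nonneg (div_nonneg hα₀ hb.le) ((R n M).response_nonneg a l))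
      (mul_nonneg (sub_nonneg.2 ((div_le_one hb).2 hα)) ((R n M).noise_nonneg a))
  sum_eq_one n M l := by
    simp only [barrettResponse]
    rw [Finset.sum_add_distrib, ← Finset.mul_sum, ← Finset.mul_sum,
      (R n M).sum_response (by omega), (R n M).sum_noise (by omega)]
    ring

theorem isResponse_barrettQuantumResponse (hd : 2 ≤ d)
    (R : (n : ℕ) → (M : POVM (Fin d) n) → RankOneRefinement M) :
    IsResponse (barrettQuantumResponse R) where
  measurable n M a := by
    unfold barrettQuantumResponse RankOneRefinement.quantumResponse
    exact Finset.measurable_fun_sum _ fun k _ =>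
      ((continuous_overlap _).measurable.const_sub 1).const_mul _
  nonneg n M a l := by
    rw [← Complex.zero_le_real, barrettQuantumResponse, RankOneRefinement.quantumResponse_eq_trace]
    exact trace_mul_nonneg (isState_hiddenState hd l).posSemidef (M.posSemidef a)
  sum_eq_one n M l := by
    rw [← Complex.ofReal_inj, Complex.ofReal_sum]
    simp only [barrettQuantumResponse, RankOneRefinement.quantumResponse_eq_trace]
    rw [← Matrix.trace_sum, ← Finset.mul_sum, M.sum_eq_one, mul_one,
      (isState_hiddenState hd l).trace_eq_one, Complex.ofReal_one]

theorem mixture_hiddenState_barrettResponse (hd : 2 ≤ d) (α : ℝ)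
    (R : (n : ℕ) → (M : POVM (Fin d) n) → RankOneRefinement M)
    (n : ℕ) (M : POVM (Fin d) n) (a : Fin n) :
    mixture (uniformUnitVec d) (hiddenState d) (barrettResponse α R n M a) =
      assemblageAtoB (wernerState d α) n M a := by
  have := isProbabilityMeasure_uniformUnitVec (d := d) (by omega)
  have hb : (barrettBound d : ℂ) ≠ 0 := by exact_mod_cast (barrettBound_pos hd).ne'
  have hd0 : (d : ℂ) ≠ 0 := by norm_cast; omega
  have hd1 : (d : ℂ) - 1 ≠ 0 := by rw [sub_ne_zero]; norm_cast; omega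
  have hsplit : barrettResponse α R n M a = fun l => α / barrettBound d * (R n M).response a l +
      (1 - α / barrettBound d) * (R n M).noise a * 1 := by
    funext l
    rw [mul_one, barrettResponse]
  rw [hsplit, mixture_add (isStateFamily_hiddenState hd)
    (((R n M).integrable_response (by omega) a).const_mul _) (integrable_const _),
    mixture_const_mul, mixture_const_mul, (R n M).mixture_hiddenState_response hd,
    mixture_hiddenState_one hd, assemblageAtoB_wernerState]
  push_cast
  rw [(R n M).noise_eq]
  match_scalars
  · field_simp
    ring
  · field_simp

theorem isLHSModel_barrettResponse (hd : 2 ≤ d) (hα₀ : 0 ≤ α) (hα : α ≤ barrettBound d)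
    (R : (n : ℕ) → (M : POVM (Fin d) n) → RankOneRefinement M) :
    IsLHSModel (assemblageAtoB (wernerState d α)) (uniformUnitVec d) (hiddenState d)
      (barrettResponse α R) where
  isProbabilityMeasure := isProbabilityMeasure_uniformUnitVec (by omega)
  measurable_state := (isStateFamily_hiddenState hd).measurable
  isState := (isStateFamily_hiddenState hd).isState
  isResponse := isResponse_barrettResponse hd hα₀ hα R
  reproduces n M a i j := by
    rw [← mixture_hiddenState_barrettResponse hd]
    rfl

end BarrettModel

end Steering

end

theorem mainTheorem4 (d : ℕ) (hd : 2 ≤ d) (α : ℝ)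
    (hα₁ : 1 / ((d : ℝ) + 1) < α)
    (hα₂ : α ≤ (3 * (d : ℝ) - 1) / ((d : ℝ) + 1) * ((d : ℝ) - 1) ^ (d - 1) * ((d : ℝ) ^ d)⁻¹) :
    Steering.IsEntangled (Steering.wernerState d α) ∧
    Nonempty ((n : ℕ) → (M : Steering.POVM (Fin d) n) → Steering.RankOneRefinement M) ∧
    (∀ R : (n : ℕ) → (M : Steering.POVM (Fin d) n) → Steering.RankOneRefinement M,
      Steering.IsLHVModel (Steering.wernerState d α) (Steering.uniformUnitVec d)
        (Steering.barrettResponse α R) (Steering.barrettQuantumResponse R) ∧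
      Steering.IsLHVModel (Steering.wernerState d α) (Steering.uniformUnitVec d)
        (Steering.barrettQuantumResponse R) (Steering.barrettResponse α R) ∧
      (∀ (n : ℕ) (M : Steering.POVM (Fin d) n) (a : Fin n) (l : Steering.UnitVec d),
        (Steering.barrettQuantumResponse R n M a l : ℂ) =
          (Steering.hiddenState d l * M.elem a).trace) ∧
      Steering.IsLHSModel (Steering.assemblageAtoB (Steering.wernerState d α))
        (Steering.uniformUnitVec d) (Steering.hiddenState d) (Steering.barrettResponse α R) ∧
      Steering.IsLHSModel (Steering.assemblageBtoA (Steering.wernerState d α))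
        (Steering.uniformUnitVec d) (Steering.hiddenState d) (Steering.barrettResponse α R)) ∧
    Steering.UnsteerableAtoB (Steering.wernerState d α) ∧
    Steering.UnsteerableBtoA (Steering.wernerState d α) := by
  have hα₀ : 0 < α := (by positivity : (0 : ℝ) < 1 / (d + 1)).trans hα₁
  have hswap : Steering.assemblageBtoA (Steering.wernerState d α) =
      Steering.assemblageAtoB (Steering.wernerState d α) := by
    rw [← Steering.assemblageAtoB_submatrix_swap, Steering.wernerState_submatrix_swap]
  have hLHS := Steering.isLHSModel_barrettResponse hd hα₀.le hα₂
  have hLHV R := (hLHS R).isLHVModel (Steering.isResponse_barrettQuantumResponse hd R)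
    fun n N b l => (R n N).quantumResponse_eq_trace b l
  let R₀ (n : ℕ) (M : Steering.POVM (Fin d) n) : Steering.RankOneRefinement M :=
    (Steering.nonempty_rankOneRefinement M).some
  have hunsteerable : Steering.UnsteerableAtoB (Steering.wernerState d α) :=
    ⟨_, _, _, _, _, hLHS R₀⟩
  refine ⟨Steering.isEntangled_wernerState hd hα₁ (hα₂.trans (Steering.barrettBound_le_one hd)),
    ⟨R₀⟩, fun R => ⟨hLHV R, ?_, fun n M a l => (R n M).quantumResponse_eq_trace a l, hLHS R, ?_⟩,
    hunsteerable, ?_⟩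
  · simpa only [Steering.wernerState_submatrix_swap] using (hLHV R).submatrix_swap
  · rw [hswap]
    exact hLHS R
  · rwa [Steering.UnsteerableBtoA, hswap]
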